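/- \begin{theorem} Let $(\Omega,\mathcal F,\mathbb P)$ be a complete probability space and let $\gamma=(\gamma_t)_{t\ge 0}$ be a standard gamma process on it, i.e. a subordinator with $\gamma_0=0$ and $\mathbb E[e^{-\lambda\gamma_t}]=(1+\lambda)^{-t}$ for all $t,\lambda\ge 0$. Let $\tau:\Omega\to(0,\infty)$ be a random variable independent of $\gamma$, with law $\mathbb P_\tau$, and let $$\zeta_t=\frac{\gamma_{t\wedge\tau}}{\gamma_\tau},\qquad t\ge 0,$$ be the gamma bridge of random length $\tau$. Let $\mathbb F^{\zeta,c}=(\mathcal F^{\zeta,c}_t)_{t\ge0}$, where $\mathcal F^{\zeta,c}_t$ is generated by $(\zeta_s)_{s\le t}$ and the $\mathbb P$-null sets, be its completed natural filtration. For $0<t<r$ and $x\in\mathbb R$ put $$\varphi_{\zeta^r_t}(x)=\frac{\Gamma(r)}{\Gamma(t)\Gamma(r-t)}\,x^{t-1}(1-x)^{r-t-1}\,\mathbb I_{(0,1)}(x),\qquad \phi_{\zeta^r_t}(x)=\frac{\varphi_{\zeta^r_t}(x)}{\int_{(t,\infty)}\varphi_{\zeta^s_t}(x)\,\mathbb P_\tau(ds)}$$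 (with $\phi_{\zeta^r_t}(x)=0$ where the denominator vanishes). Then $\tau$ is an $\mathbb F^{\zeta,c}$-stopping time, $\zeta$ is a semimartingale in $\mathbb F^{\zeta,c}$, and its canonical decomposition (the sum of a local martingale and a predictable process of finite variation that vanishes at $0$) is given, $\mathbb P$-almost surely for all $t\ge 0$, by $$\zeta_t=\widetilde N_t+\int_0^t(1-\zeta_s)\int_{(s,\infty)}\frac{1}{r-s}\,\phi_{\zeta^r_s}(\zeta_s)\,\mathbb P_\tau(dr)\,\mathbb I_{\{0<\zeta_s<1\}}\,ds ,$$ where all the integrals converge almost surely and $\widetilde N$ is an $\mathbb F^{\zeta,c}$-martingale stopped at $\tau$, i.e. $\widetilde N_t=\widetilde N_{t\wedge\tau}$ for all $t\ge0$ almost surely. \end{theorem} -/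

import Mathlib

open MeasureTheory ProbabilityTheory Filter Topology
open scoped NNReal ENNReal

noncomputable section

/-- A path on `[0, ∞)` is càdlàg: right-continuous with (finite) left limits. -/
def IsCadlag (f : ℝ≥0 → ℝ) : Prop :=
  ∀ t, ContinuousWithinAt f (Set.Ici t) t ∧ ∃ l, Tendsto f (𝓝[<] t) (𝓝 l)

/-- A standard gamma process: the subordinator (started at `0`, with independent and stationary
increments and almost surely nondecreasing càdlàg paths) whose Laplace transform is
`E exp (-l γ_t) = (1 + l)^(-t)` for `l ≥ 0`. -/
structure IsStandardGammaProcess {Ω : Type*} [MeasurableSpace Ω] (γ : ℝ≥0 → Ω → ℝ)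
    (P : Measure Ω) : Prop where
  measurable : ∀ t, Measurable (γ t)
  zero : ∀ᵐ ω ∂P, γ 0 ω = 0
  indepIncrements : HasIndepIncrements γ P
  stationaryIncrements : ∀ s t, IdentDistrib (fun ω => γ (s + t) ω - γ s ω) (γ t) P P
  monotone : ∀ᵐ ω ∂P, Monotone (fun t => γ t ω)
  cadlag : ∀ᵐ ω ∂P, IsCadlag (fun t => γ t ω)
  laplace : ∀ (t : ℝ≥0) (l : ℝ), 0 ≤ l →
    ∫ ω, Real.exp (-(l * γ t ω)) ∂P = (1 + l) ^ (-(t : ℝ))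

/-- The gamma bridge of deterministic length `r`: `ζ^r_t = γ_{t ∧ r} / γ_r`. -/
def gammaBridge {Ω : Type*} (γ : ℝ≥0 → Ω → ℝ) (r t : ℝ≥0) (ω : Ω) : ℝ :=
  γ (min t r) ω / γ r ω

/-- The gamma bridge of random length `τ`: `ζ_t = γ_{t ∧ τ} / γ_τ`. -/
def randomGammaBridge {Ω : Type*} (γ : ℝ≥0 → Ω → ℝ) (τ : Ω → ℝ≥0) (t : ℝ≥0) (ω : Ω) : ℝ :=
  gammaBridge γ (τ ω) t ω

/-- On a complete probability space, the value of a gamma process at a random time is a random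
variable. -/
theorem IsStandardGammaProcess.measurable_at {Ω : Type*} [MeasurableSpace Ω]
    {γ : ℝ≥0 → Ω → ℝ} {P : Measure Ω} [P.IsComplete] (hγ : IsStandardGammaProcess γ P)
    {σ : Ω → ℝ≥0} (hσ : Measurable σ) : Measurable (fun ω => γ (σ ω) ω) := by
  obtain ⟨e, he⟩ : ∃ e : ℕ → ℕ → ℝ≥0, ∀ n k, e n k = ((k : ℝ≥0) + 1) / (n + 1) :=
    ⟨fun n k => ((k : ℝ≥0) + 1) / (n + 1), fun _ _ => rfl⟩
  obtain ⟨d, hd⟩ : ∃ d : ℕ → ℝ≥0 → ℝ≥0, ∀ n x, d n x = e n ⌊x * (n + 1)⌋₊ :=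
    ⟨fun n x => e n ⌊x * (n + 1)⌋₊, fun _ _ => rfl⟩
  have hdlt : ∀ n x, x < d n x := fun n x => by
    have hn : (0 : ℝ≥0) < n + 1 := by positivity
    rw [hd, he, lt_div_iff₀ hn]
    exact Nat.lt_floor_add_one _
  have hdle : ∀ n x, d n x ≤ x + 1 / (n + 1) := fun n x => by
    have hn : (0 : ℝ≥0) < n + 1 := by positivity
    have h2 : ((⌊x * (n + 1)⌋₊ : ℝ≥0) + 1) ≤ x * (n + 1) + 1 :=
      add_le_add (Nat.floor_le (by positivity)) le_rfl
    rw [hd, he, div_le_iff₀ hn, add_mul, one_div, inv_mul_cancel₀ hn.ne']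
    exact h2
  have hdt : ∀ x, Tendsto (fun n => d n x) atTop (𝓝 x) := fun x => by
    have h1 : Tendsto (fun n : ℕ => x + 1 / ((n : ℝ≥0) + 1)) atTop (𝓝 (x + 0)) :=
      tendsto_const_nhds.add tendsto_one_div_add_atTop_nhds_zero_nat
    rw [add_zero] at h1
    exact tendsto_of_tendsto_of_tendsto_of_le_of_le tendsto_const_nhds h1
      (fun n => (hdlt n x).le) (fun n => hdle n x)
  have hmeas : ∀ n, Measurable (fun ω => γ (d n (σ ω)) ω) := fun n => by
    simp only [hd]
    have h1 : Measurable (fun p : ℕ × Ω => γ (e n p.1) p.2) :=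
      measurable_from_prod_countable_right (fun k => hγ.measurable (e n k))
    have h2 : Measurable (fun ω => (⌊σ ω * (n + 1)⌋₊, ω)) :=
      (Nat.measurable_floor.comp (hσ.mul_const _)).prodMk measurable_id
    exact h1.comp h2
  have hlim : ∀ᵐ ω ∂P, Tendsto (fun n => γ (d n (σ ω)) ω) atTop (𝓝 (γ (σ ω) ω)) := by
    filter_upwards [hγ.cadlag] with ω hω
    exact (hω (σ ω)).1.tendsto.comp (tendsto_nhdsWithin_iff.2
      ⟨hdt _, Eventually.of_forall fun n => (hdlt n _).le⟩)
  have hae : AEMeasurable (fun ω => γ (σ ω) ω) P :=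
    aemeasurable_of_tendsto_metrizable_ae _ (fun n => (hmeas n).aemeasurable) hlim
  exact hae.measurable_mk.congr_ae hae.ae_eq_mk.symm

theorem IsStandardGammaProcess.measurable_randomGammaBridge {Ω : Type*} [MeasurableSpace Ω]
    {γ : ℝ≥0 → Ω → ℝ} {P : Measure Ω} [P.IsComplete] (hγ : IsStandardGammaProcess γ P)
    {τ : Ω → ℝ≥0} (hτ : Measurable τ) (t : ℝ≥0) : Measurable (randomGammaBridge γ τ t) :=
  (hγ.measurable_at (measurable_const.min hτ)).div (hγ.measurable_at hτ)

/-- The completed natural filtration of a process `Y` on a complete probability space: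
`σ(Y_s, s ≤ t) ∨ {null sets}`. -/
def completedNaturalFiltration {Ω : Type*} [mΩ : MeasurableSpace Ω] (P : Measure Ω)
    [P.IsComplete] (Y : ℝ≥0 → Ω → ℝ) (hY : ∀ t, Measurable (Y t)) : Filtration ℝ≥0 mΩ where
  seq t := (⨆ s ≤ t, MeasurableSpace.comap (Y s) inferInstance) ⊔
    MeasurableSpace.generateFrom {N : Set Ω | P N = 0}
  mono' _ _ hst := sup_le_sup_right (biSup_mono fun _ hu => hu.trans hst) _
  le' _ := sup_le (iSup₂_le fun s _ => (hY s).comap_le)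
    (MeasurableSpace.generateFrom_le fun _ hN => measurableSet_of_null hN)

/-- The completed natural filtration of the gamma bridge of random length `τ`. -/
def bridgeFiltration {Ω : Type*} [mΩ : MeasurableSpace Ω] {γ : ℝ≥0 → Ω → ℝ} {P : Measure Ω}
    [P.IsComplete] (hγ : IsStandardGammaProcess γ P) {τ : Ω → ℝ≥0} (hτ : Measurable τ) :
    Filtration ℝ≥0 mΩ :=
  completedNaturalFiltration P (randomGammaBridge γ τ) (hγ.measurable_randomGammaBridge hτ)

/-- A càdlàg local martingale: along some localizing sequence, the stopped processes are càdlàg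
martingales. -/
def IsLocalMartingale {Ω : Type*} [mΩ : MeasurableSpace Ω] (M : ℝ≥0 → Ω → ℝ)
    (ℱ : Filtration ℝ≥0 mΩ) (P : Measure Ω) : Prop :=
  Locally (fun X : ℝ≥0 → Ω → ℝ =>
    Martingale X ℱ P ∧ ∀ᵐ ω ∂P, IsCadlag (fun t => X t ω)) ℱ M P

/-- Almost all paths are càdlàg, vanish at `0` and have finite variation on compact intervals. -/
def HasFiniteVariationPaths {Ω : Type*} [MeasurableSpace Ω] (A : ℝ≥0 → Ω → ℝ)
    (P : Measure Ω) : Prop :=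
  ∀ᵐ ω ∂P, A 0 ω = 0 ∧ IsCadlag (fun t => A t ω) ∧
    LocallyBoundedVariationOn (fun t => A t ω) Set.univ

/-- `Y` is a semimartingale: an adapted càdlàg process which is the sum of a local martingale and
of an adapted process of finite variation. -/
structure IsSemimartingale {Ω : Type*} [mΩ : MeasurableSpace Ω] (Y : ℝ≥0 → Ω → ℝ)
    (ℱ : Filtration ℝ≥0 mΩ) (P : Measure Ω) : Prop where
  adapted : StronglyAdapted ℱ Y
  cadlag : ∀ᵐ ω ∂P, IsCadlag (fun t => Y t ω)
  exists_decomposition : ∃ M V : ℝ≥0 → Ω → ℝ, IsLocalMartingale M ℱ P ∧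
    StronglyAdapted ℱ V ∧ HasFiniteVariationPaths V P ∧
    ∀ᵐ ω ∂P, ∀ t, Y t ω = M t ω + V t ω

/-- `Y = N + A` is the canonical decomposition of the (special) semimartingale `Y`: `N` is a local
martingale and `A` is a *predictable* process of finite variation with `A_0 = 0`. -/
structure IsCanonicalDecomposition {Ω : Type*} [mΩ : MeasurableSpace Ω] (Y N A : ℝ≥0 → Ω → ℝ)
    (ℱ : Filtration ℝ≥0 mΩ) (P : Measure Ω) : Prop where
  localMartingale : IsLocalMartingale N ℱ P
  predictable : IsStronglyPredictable ℱ A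
  finiteVariation : HasFiniteVariationPaths A P
  eq_add : ∀ᵐ ω ∂P, ∀ t, Y t ω = N t ω + A t ω

/-- The density of `ζ^r_t` for `0 < t < r`, i.e. that of the beta distribution `β(t, r - t)`:
`Γ(r) / (Γ(t) Γ(r - t)) x^(t-1) (1 - x)^(r-t-1)` on `(0, 1)`. -/
def bridgeDensity (t r : ℝ≥0) (x : ℝ) : ℝ :=
  betaPDFReal (t : ℝ) ((r : ℝ) - (t : ℝ)) x

/-- The function `φ_{ζ^r_t}(x)`, for a law `ν` of the random length. -/
def bridgePhi (ν : Measure ℝ≥0) (t r : ℝ≥0) (x : ℝ) : ℝ :=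
  bridgeDensity t r x / ∫ s in Set.Ioi t, bridgeDensity t s x ∂ν

/-- The drift
`(1 - x) ∫_{(s,∞)} (r - s)⁻¹ φ_{ζ^r_s}(x) ν(dr) 1_{0 < x < 1}`. -/
def bridgeDrift (ν : Measure ℝ≥0) (s : ℝ≥0) (x : ℝ) : ℝ :=
  (Set.Ioo (0 : ℝ) 1).indicator
    (fun y => (1 - y) * ∫ r in Set.Ioi s, ((r : ℝ) - (s : ℝ))⁻¹ * bridgePhi ν s r y ∂ν) x

end

/-!
The gamma process has independent increments, and the beta-gamma algebra
(`map_div_add_gammaMeasure_prod`) makes ratios of its values independent of the values themselves: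
the path up to time `u`, normalized by `γ_u`, is independent of `γ_u`
(`IsStandardGammaProcess.indepFun_normalized`) and hence of `γ_u / γ_r` for `r ≥ u`. Two facts about
the bridge `ζ^r` of deterministic length `r` follow.

* Given `ζ^r_u = x`, the past of `ζ^r` before `u` has a law which does not depend on `r`
  (`IsStandardGammaProcess.lintegral_gammaBridge_past`), while `ζ^r_u` has the beta density
  `bridgeDensity u r`. So the only information about the length `τ` in the past of `ζ` before `u`,
  on `{u < τ}`, is the value `ζ_u`, and by the Bayes formula the drift at time `u` is the
  conditional expectation of `(1 - ζ_u) / (τ - u)` on `{u < τ}` given the past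
  (`lintegral_bridgeDrift_mul`).
* The process `(1 - ζ^r_u) / (r - u)` is a martingale on `[0, r)`
  (`IsStandardGammaProcess.lintegral_one_sub_gammaBridge`).

By the second fact, on an event of the past of `s`, the mean of `(1 - ζ_u) / (τ - u)` on `{u < τ}`
does not change as long as `s ≤ u` and `τ` is fixed. Integrating over `u` in `(s, t]` gives exactly
the mean increment of `ζ` over `(s, t]` (`lintegral_lintegral_bridgeDrift_mul`). With `s = 0` this
shows that the drift is integrable in time, and in general that the bridge minus its integrated
drift is a martingale. These computations are made with integrals in `[0, ∞]`, so that no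
integrability is needed beforehand.

The integrated drift is nondecreasing, continuous and adapted, therefore predictable. It is built
from a version of the bridge which is regular for every `ω`, and completeness of the filtration
keeps it adapted. The integrals over the length converge because the beta density is bounded in `r`,
with a bound of order `r - s` near `r = s` (`betaPDFReal_le`). Finally the bridge is below `1`
before `τ` and equal to `1` from `τ` on, since gamma paths are strictly increasing, so `τ` is a
stopping time, and the drift vanishes after `τ`.
-/

/-! ### Laplace transforms and gamma laws -/

/-- A finite measure on `[0, ∞)` is determined by the values of its Laplace transform at the natural
numbers: these are the moments of the image under `x ↦ exp (-x)`, which lives on `[0, 1]`, where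
polynomials are dense. -/
theorem MeasureTheory.Measure.ext_of_laplace_nat {μ ν : Measure ℝ} [IsFiniteMeasure μ]
    [IsFiniteMeasure ν] (hμ : ∀ᵐ x ∂μ, 0 ≤ x) (hν : ∀ᵐ x ∂ν, 0 ≤ x)
    (h : ∀ n : ℕ, ∫ x, Real.exp (-(n * x)) ∂μ = ∫ x, Real.exp (-(n * x)) ∂ν) : μ = ν := by
  have he : Measurable (fun x : ℝ => Real.exp (-x)) := by fun_prop
  have hmono : ∀ (κ : Measure ℝ) [IsFiniteMeasure κ], (∀ᵐ x ∂κ, 0 ≤ x) → ∀ n : ℕ,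
      Integrable (fun x => Real.exp (-x) ^ n) κ := fun κ _ hκ n => by
    refine Integrable.of_bound (C := 1) (by fun_prop) ?_
    filter_upwards [hκ] with x hx
    rw [Real.norm_of_nonneg (by positivity)]
    exact pow_le_one₀ (by positivity) (Real.exp_le_one_iff.2 (by linarith))
  have hint : ∀ (κ : Measure ℝ) [IsFiniteMeasure κ], (∀ᵐ x ∂κ, 0 ≤ x) → ∀ p : Polynomial ℝ,
      Integrable (fun x => p.eval (Real.exp (-x))) κ := fun κ _ hκ p => by
    simp only [Polynomial.eval_eq_sum_range]
    exact integrable_finsetSum _ fun n _ => (hmono κ hκ n).const_mul _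
  have hpoly : ∀ p : Polynomial ℝ,
      ∫ x, p.eval (Real.exp (-x)) ∂μ = ∫ x, p.eval (Real.exp (-x)) ∂ν := fun p => by
    simp only [Polynomial.eval_eq_sum_range]
    rw [integral_finsetSum _ fun n _ => (hmono μ hμ n).const_mul _,
      integral_finsetSum _ fun n _ => (hmono ν hν n).const_mul _]
    refine Finset.sum_congr rfl fun n _ => ?_
    rw [integral_const_mul, integral_const_mul]
    have := h n
    simp only [← mul_neg, Real.exp_nat_mul] at this
    rw [this]
  have hmap : μ.map (fun x => Real.exp (-x)) = ν.map (fun x => Real.exp (-x)) := by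
    refine ext_of_forall_integral_eq_of_IsFiniteMeasure fun f => ?_
    have hf : Measurable f := f.continuous.measurable
    rw [integral_map he.aemeasurable hf.aestronglyMeasurable,
      integral_map he.aemeasurable hf.aestronglyMeasurable]
    have hfi : ∀ (κ : Measure ℝ) [IsFiniteMeasure κ],
        Integrable (fun x => f (Real.exp (-x))) κ := fun κ _ =>
      Integrable.of_bound (C := ‖f‖) (hf.comp he).aestronglyMeasurable
        (ae_of_all _ fun x => f.norm_coe_le_norm _)
    have hclose : ∀ (κ : Measure ℝ) [IsFiniteMeasure κ], (∀ᵐ x ∂κ, 0 ≤ x) →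
        ∀ (p : Polynomial ℝ) (ε : ℝ), (∀ x ∈ Set.Icc (0 : ℝ) 1, |p.eval x - f x| < ε) →
        |∫ x, p.eval (Real.exp (-x)) ∂κ - ∫ x, f (Real.exp (-x)) ∂κ| ≤ ε * κ.real Set.univ := by
      intro κ _ hκ p ε hp
      rw [← integral_sub (hint κ hκ p) (hfi κ), ← Real.norm_eq_abs]
      refine norm_integral_le_of_norm_le_const ?_
      filter_upwards [hκ] with x hx
      exact (hp _ ⟨by positivity, Real.exp_le_one_iff.2 (by linarith)⟩).le
    refine eq_of_forall_dist_le fun ε hε => ?_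
    set c := μ.real Set.univ + ν.real Set.univ + 1 with hc
    have hc0 : 0 < c := by positivity
    obtain ⟨p, hp⟩ := exists_polynomial_near_of_continuousOn 0 1 f f.continuous.continuousOn
      (ε / c) (by positivity)
    have h1 := hclose μ hμ p _ hp
    have h2 := hclose ν hν p _ hp
    rw [hpoly p] at h1
    rw [Real.dist_eq]
    have h3 : ε / c * μ.real Set.univ + ε / c * ν.real Set.univ ≤ ε := by
      rw [← mul_add, div_mul_eq_mul_div, div_le_iff₀ hc0]
      exact mul_le_mul_of_nonneg_left (by linarith) hε.le
    rw [abs_sub_comm] at h1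
    have := abs_add_le (∫ x, f (Real.exp (-x)) ∂μ - ∫ x, p.eval (Real.exp (-x)) ∂ν)
      (∫ x, p.eval (Real.exp (-x)) ∂ν - ∫ x, f (Real.exp (-x)) ∂ν)
    rw [sub_add_sub_cancel] at this
    linarith
  have hlog : Measurable (fun y : ℝ => -Real.log y) := by fun_prop
  have hid : ∀ κ : Measure ℝ, (κ.map (fun x => Real.exp (-x))).map (fun y => -Real.log y) = κ :=
    fun κ => by
      rw [Measure.map_map hlog he]
      simp [Function.comp_def]
  rw [← hid μ, hmap, hid ν]

theorem gammaMeasure_ae_pos (a r : ℝ) : ∀ᵐ x ∂gammaMeasure a r, 0 < x := by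
  have hs : MeasurableSet {x : ℝ | ¬ 0 < x} := by measurability
  rw [ae_iff, gammaMeasure, withDensity_apply _ hs]
  have : {x : ℝ | ¬ 0 < x} = Set.Iic 0 := by ext; simp
  rw [this, ← setLIntegral_congr Iio_ae_eq_Iic]
  exact lintegral_gammaPDF_of_nonpos le_rfl

/-- The Laplace transform of the gamma law with shape `a` and rate `1`. -/
theorem integral_exp_neg_mul_gammaMeasure {a l : ℝ} (ha : 0 < a) (hl : 0 ≤ l) :
    ∫ x, Real.exp (-(l * x)) ∂gammaMeasure a 1 = (1 + l) ^ (-a) := by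
  have hm : Measurable (gammaPDF a 1) := (measurable_gammaPDFReal a 1).ennreal_ofReal
  rw [integral_eq_lintegral_of_nonneg_ae (ae_of_all _ fun x => by positivity) (by fun_prop),
    gammaMeasure, lintegral_withDensity_eq_lintegral_mul _ hm (by fun_prop)]
  have hl1 : 0 < 1 + l := by linarith
  have : ∀ x, (gammaPDF a 1 * fun x => ENNReal.ofReal (Real.exp (-(l * x)))) x =
      ENNReal.ofReal ((1 + l) ^ (-a)) * gammaPDF a (1 + l) x := fun x => by
    rw [Pi.mul_apply, gammaPDF, gammaPDF, ← ENNReal.ofReal_mul (gammaPDFReal_nonneg ha one_pos x),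
      ← ENNReal.ofReal_mul (by positivity)]
    congr 1
    unfold gammaPDFReal
    split_ifs
    · have h1 : Real.exp (-((1 + l) * x)) = Real.exp (-(1 * x)) * Real.exp (-(l * x)) := by
        rw [← Real.exp_add]; ring_nf
      have h2 : (1 + l) ^ (-a) * (1 + l) ^ a = 1 := by
        rw [← Real.rpow_add hl1]; simp
      rw [h1, Real.one_rpow]
      linear_combination (-(1 / Real.Gamma a * x ^ (a - 1) * Real.exp (-(1 * x)) *
        Real.exp (-(l * x)))) * h2
    · simp
  simp only [this]
  have hm' : Measurable (gammaPDF a (1 + l)) := (measurable_gammaPDFReal a _).ennreal_ofReal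
  rw [lintegral_const_mul _ hm', lintegral_gammaPDF_eq_one ha hl1, mul_one,
    ENNReal.toReal_ofReal (by positivity)]

theorem eq_gammaMeasure_of_laplace {μ : Measure ℝ} [IsProbabilityMeasure μ] {a : ℝ} (ha : 0 < a)
    (hμ : ∀ᵐ x ∂μ, 0 ≤ x)
    (h : ∀ l : ℝ, 0 ≤ l → ∫ x, Real.exp (-(l * x)) ∂μ = (1 + l) ^ (-a)) :
    μ = gammaMeasure a 1 := by
  have := isProbabilityMeasure_gammaMeasure ha one_pos
  refine Measure.ext_of_laplace_nat hμ ?_ fun n => ?_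
  · filter_upwards [gammaMeasure_ae_pos a 1] with x hx using hx.le
  · rw [h n n.cast_nonneg, integral_exp_neg_mul_gammaMeasure ha n.cast_nonneg]

/-! ### The beta-gamma algebra -/

theorem lintegral_eq_ofReal_mul_lintegral_comp_mul_left {f : ℝ → ℝ≥0∞} (hf : Measurable f) {z : ℝ}
    (hz : 0 < z) : ∫⁻ x, f x = ENNReal.ofReal z * ∫⁻ w, f (z * w) := by
  conv_lhs => rw [← Real.smul_map_volume_mul_left hz.ne', lintegral_smul_measure,
    lintegral_map hf (measurable_const_mul z), abs_of_pos hz]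
  rfl

theorem measurable_gammaPDF (a r : ℝ) : Measurable (gammaPDF a r) :=
  (measurable_gammaPDFReal a r).ennreal_ofReal

theorem measurable_betaPDF (a b : ℝ) : Measurable (betaPDF a b) :=
  (measurable_betaPDFReal a b).ennreal_ofReal

theorem ofReal_mul_gammaPDF_mul_gammaPDF {a b z w : ℝ} (ha : 0 < a) (hb : 0 < b) (hz : 0 < z)
    (hw0 : w ≠ 0) (hw1 : w ≠ 1) :
    ENNReal.ofReal z * (gammaPDF a 1 (z * w) * gammaPDF b 1 (z - z * w)) =
      gammaPDF (a + b) 1 z * betaPDF a b w := by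
  rcases lt_or_gt_of_ne hw0 with hw | hw
  · rw [gammaPDF_of_neg (by nlinarith), betaPDF_eq_zero_of_nonpos hw.le]; simp
  rcases lt_or_gt_of_ne hw1 with hw' | hw'
  swap
  · rw [gammaPDF_of_neg (a := b) (by nlinarith), betaPDF_eq_zero_of_one_le hw'.le]; simp
  have h1w : 0 < 1 - w := by linarith
  rw [gammaPDF_of_nonneg (by positivity), gammaPDF_of_nonneg (by nlinarith),
    gammaPDF_of_nonneg hz.le, betaPDF_of_pos_lt_one hw hw',
    ← ENNReal.ofReal_mul (by positivity), ← ENNReal.ofReal_mul hz.le,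
    ← ENNReal.ofReal_mul (by positivity)]
  congr 1
  rw [show z - z * w = z * (1 - w) by ring, Real.mul_rpow hz.le hw.le, Real.mul_rpow hz.le h1w.le,
    beta, show a + b - 1 = 1 + (a - 1) + (b - 1) by ring, Real.rpow_add hz, Real.rpow_add hz,
    Real.rpow_one, show Real.exp (-(1 * z)) = Real.exp (-(1 * (z * w))) *
      Real.exp (-(1 * (z * (1 - w)))) by rw [← Real.exp_add]; ring_nf]
  have h1 := (Real.Gamma_pos_of_pos ha).ne'
  have h2 := (Real.Gamma_pos_of_pos hb).ne'
  have h3 := (Real.Gamma_pos_of_pos (add_pos ha hb)).ne'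
  simp only [Real.one_rpow]
  field_simp

/-- The beta-gamma algebra: if `X` and `Y` are independent with laws `Γ(a)` and `Γ(b)`, then
`X / (X + Y)` and `X + Y` are independent with laws `B(a, b)` and `Γ(a + b)`. -/
theorem map_div_add_gammaMeasure_prod {a b : ℝ} (ha : 0 < a) (hb : 0 < b) :
    ((gammaMeasure a 1).prod (gammaMeasure b 1)).map (fun p => (p.1 / (p.1 + p.2), p.1 + p.2)) =
      (betaMeasure a b).prod (gammaMeasure (a + b) 1) := by
  have := isProbabilityMeasure_gammaMeasure ha one_pos
  have := isProbabilityMeasure_gammaMeasure hb one_pos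
  have := isProbabilityMeasure_gammaMeasure (add_pos ha hb) one_pos
  have := isProbabilityMeasureBeta ha hb
  have hga := measurable_gammaPDF a 1
  have hgb := measurable_gammaPDF b 1
  have hgs := measurable_gammaPDF (a + b) 1
  have hbe := measurable_betaPDF a b
  refine Measure.ext_of_lintegral _ fun f hf => ?_
  have hT : Measurable (fun p : ℝ × ℝ => (p.1 / (p.1 + p.2), p.1 + p.2)) := by fun_prop
  rw [lintegral_map hf hT, lintegral_prod (fun p : ℝ × ℝ => f (p.1 / (p.1 + p.2), p.1 + p.2))
      (hf.comp hT).aemeasurable,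
    lintegral_prod_symm _ hf.aemeasurable]
  simp only [gammaMeasure, betaMeasure]
  rw [lintegral_withDensity_eq_lintegral_mul _ hga
      (Measurable.lintegral_prod_right' (ν := volume.withDensity (gammaPDF b 1))
        (f := fun p : ℝ × ℝ => f (p.1 / (p.1 + p.2), p.1 + p.2)) (hf.comp hT)),
    lintegral_withDensity_eq_lintegral_mul _ hgs
      (Measurable.lintegral_prod_left' (μ := volume.withDensity (betaPDF a b)) hf)]
  have hL : ∀ x, (gammaPDF a 1 * fun x => ∫⁻ y, f (x / (x + y), x + y)
        ∂volume.withDensity (gammaPDF b 1)) x =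
      ∫⁻ z, gammaPDF a 1 x * (gammaPDF b 1 (z - x) * f (x / z, z)) := fun x => by
    rw [Pi.mul_apply, lintegral_withDensity_eq_lintegral_mul _ hgb (by fun_prop),
      ← lintegral_sub_right_eq_self _ x, lintegral_const_mul _ (by fun_prop)]
    simp
  have hR : ∀ z, (gammaPDF (a + b) 1 * fun z => ∫⁻ w, f (w, z)
        ∂volume.withDensity (betaPDF a b)) z =
      ∫⁻ w, gammaPDF (a + b) 1 z * betaPDF a b w * f (w, z) := fun z => by
    rw [Pi.mul_apply, lintegral_withDensity_eq_lintegral_mul _ hbe (by fun_prop),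
      ← lintegral_const_mul _ (by fun_prop)]
    simp only [Pi.mul_apply, mul_assoc]
  simp only [hL, hR]
  rw [lintegral_lintegral_swap (by fun_prop)]
  refine lintegral_congr_ae ?_
  have hne : ∀ c : ℝ, ∀ᵐ x : ℝ, x ≠ c := fun c => by simp [ae_iff]
  filter_upwards [hne 0] with z hz0
  rcases lt_or_gt_of_ne hz0 with hz | hz
  · rw [gammaPDF_of_neg hz]
    simp only [zero_mul, lintegral_zero]
    refine (lintegral_eq_zero_iff (by fun_prop)).2 (ae_of_all _ fun x => ?_)
    rcases lt_or_ge x 0 with hx | hx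
    · simp [gammaPDF_of_neg hx]
    · simp [gammaPDF_of_neg (a := b) (r := 1) (show z - x < 0 by linarith)]
  · rw [lintegral_eq_ofReal_mul_lintegral_comp_mul_left (by fun_prop) hz,
      ← lintegral_const_mul _ (by fun_prop)]
    refine lintegral_congr_ae ?_
    filter_upwards [hne 0, hne 1] with w hw0 hw1
    rw [← ofReal_mul_gammaPDF_mul_gammaPDF ha hb hz hw0 hw1, mul_div_cancel_left₀ _ hz.ne']
    ring

theorem lintegral_one_sub_betaMeasure {a b : ℝ} (ha : 0 < a) (hb : 0 < b) :
    ∫⁻ w, ENNReal.ofReal (1 - w) ∂betaMeasure a b = ENNReal.ofReal (b / (a + b)) := by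
  have hb1 : 0 < b + 1 := by linarith
  rw [betaMeasure, lintegral_withDensity_eq_lintegral_mul _ (measurable_betaPDF a b) (by fun_prop)]
  have : ∀ w, (betaPDF a b * fun w => ENNReal.ofReal (1 - w)) w =
      ENNReal.ofReal (b / (a + b)) * betaPDF a (b + 1) w := fun w => by
    rw [Pi.mul_apply]
    rcases le_or_gt w 0 with hw | hw
    · simp [betaPDF_eq_zero_of_nonpos hw]
    rcases le_or_gt 1 w with hw' | hw'
    · simp [betaPDF_eq_zero_of_one_le hw']
    have h1w : 0 < 1 - w := by linarith
    have h0 := beta_pos ha hb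
    rw [betaPDF_of_pos_lt_one hw hw', betaPDF_of_pos_lt_one hw hw',
      ← ENNReal.ofReal_mul (by positivity), ← ENNReal.ofReal_mul (by positivity)]
    congr 1
    rw [show b + 1 - 1 = (b - 1) + 1 by ring, Real.rpow_add h1w, Real.rpow_one, beta, beta,
      ← add_assoc, Real.Gamma_add_one hb.ne', Real.Gamma_add_one (add_pos ha hb).ne']
    have h1 := (Real.Gamma_pos_of_pos ha).ne'
    have h2 := (Real.Gamma_pos_of_pos hb).ne'
    have h3 := (Real.Gamma_pos_of_pos (add_pos ha hb)).ne'
    have h4 := (add_pos ha hb).ne'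
    field_simp
  simp only [this]
  rw [lintegral_const_mul _ (measurable_betaPDF _ _), lintegral_betaPDF_eq_one ha hb1, mul_one]

/-! ### Bounds for the bridge density -/

/-- A bound for the beta density which is uniform on compact subsets of `(0, 1)` and vanishes
linearly in `b`. It holds because `B(a, b + 1)` gives `(0, x]` at most the mass `1`, while its
density there is at least a constant multiple of `(1 - x) ^ b * y ^ (a - 1)`. -/
theorem betaPDFReal_le {a b x : ℝ} (ha : 0 < a) (hb : 0 < b) (hx0 : 0 < x) (hx1 : x < 1) :
    betaPDFReal a b x ≤ a * b / ((a + b) * (x * (1 - x))) := by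
  have h1x : 0 < 1 - x := by linarith
  have hb1 : 0 < b + 1 := by linarith
  have hB := beta_pos ha hb
  have hB1 := beta_pos ha hb1
  have hmass : ENNReal.ofReal (1 / beta a (b + 1) * (1 - x) ^ b * (x ^ a / a)) ≤ 1 := by
    have hint : IntegrableOn (fun y : ℝ => 1 / beta a (b + 1) * (1 - x) ^ b * y ^ (a - 1))
        (Set.Ioc 0 x) := by
      rw [← intervalIntegrable_iff_integrableOn_Ioc_of_le hx0.le]
      exact (intervalIntegral.intervalIntegrable_rpow' (by linarith)).const_mul _
    have hval : ∫ y in Set.Ioc 0 x, 1 / beta a (b + 1) * (1 - x) ^ b * y ^ (a - 1) =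
        1 / beta a (b + 1) * (1 - x) ^ b * (x ^ a / a) := by
      rw [← intervalIntegral.integral_of_le hx0.le, intervalIntegral.integral_const_mul,
        integral_rpow (Or.inl (by linarith)), sub_add_cancel, Real.zero_rpow ha.ne', sub_zero]
    rw [← hval, ofReal_integral_eq_lintegral_ofReal hint, ← lintegral_betaPDF_eq_one ha hb1]
    · refine (setLIntegral_mono_ae (measurable_betaPDF a (b + 1)).aemeasurable
        (ae_of_all _ fun y hy => ?_)).trans (setLIntegral_le_lintegral _ _)
      have hy1 : y < 1 := hy.2.trans_lt hx1
      rw [betaPDF_of_pos_lt_one hy.1 hy1]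
      refine ENNReal.ofReal_le_ofReal ?_
      rw [mul_right_comm, add_sub_cancel_right]
      have := hy.1
      gcongr
      exact hy.2
    · refine ae_restrict_of_forall_mem measurableSet_Ioc fun y hy => ?_
      have := hy.1
      simp only [Pi.zero_apply]
      positivity
  rw [ENNReal.ofReal_le_one] at hmass
  have hBB : beta a (b + 1) = b / (a + b) * beta a b := by
    rw [beta, beta, ← add_assoc, Real.Gamma_add_one hb.ne', Real.Gamma_add_one (add_pos ha hb).ne']
    have h3 := (Real.Gamma_pos_of_pos (add_pos ha hb)).ne'
    have h4 := (add_pos ha hb).ne'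
    field_simp
  rw [hBB] at hmass
  rw [betaPDFReal, if_pos ⟨hx0, hx1⟩, Real.rpow_sub_one hx0.ne', Real.rpow_sub_one h1x.ne']
  have e1 : 1 / beta a b * (x ^ a / x) * ((1 - x) ^ b / (1 - x)) =
      (1 / (b / (a + b) * beta a b) * (1 - x) ^ b * (x ^ a / a)) *
        (a * b / ((a + b) * (x * (1 - x)))) := by
    have h4 := (add_pos ha hb).ne'
    field_simp
  rw [e1]
  exact mul_le_of_le_one_left (by positivity) hmass

/-- The Gamma function is a pointwise limit of Euler's products, at its poles as well. -/
theorem measurable_realGamma : Measurable Real.Gamma := by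
  refine measurable_of_tendsto_metrizable (f := fun n x => Real.GammaSeq x n) (fun n => ?_)
    (tendsto_pi_nhds.2 Real.GammaSeq_tendsto_Gamma)
  unfold Real.GammaSeq
  fun_prop

theorem measurable_betaPDFReal_uncurry :
    Measurable (fun p : ℝ × ℝ × ℝ => betaPDFReal p.1 p.2.1 p.2.2) := by
  have hG := measurable_realGamma
  unfold betaPDFReal beta
  refine Measurable.ite ?_ (by fun_prop) (by fun_prop)
  exact (measurableSet_lt measurable_const measurable_snd.snd).inter
    (measurableSet_lt measurable_snd.snd measurable_const)

/-! ### The drift of the bridge -/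

theorem measurable_bridgeDensity :
    Measurable (fun p : ℝ≥0 × ℝ≥0 × ℝ => bridgeDensity p.1 p.2.1 p.2.2) :=
  measurable_betaPDFReal_uncurry.comp
    (f := fun p : ℝ≥0 × ℝ≥0 × ℝ => ((p.1 : ℝ), (p.2.1 : ℝ) - (p.1 : ℝ), p.2.2)) (by fun_prop)

theorem bridgeDensity_eq_zero {s r : ℝ≥0} {x : ℝ} (hx : x ∉ Set.Ioo (0 : ℝ) 1) :
    bridgeDensity s r x = 0 :=
  if_neg hx

-- The normalizing constant `beta 0 b` is `0`, because `Real.Gamma 0 = 0`.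
theorem bridgeDensity_zero_left (r : ℝ≥0) (x : ℝ) : bridgeDensity 0 r x = 0 := by
  simp [bridgeDensity, betaPDFReal, beta]

theorem bridgeDensity_nonneg {s r : ℝ≥0} (hsr : s < r) (x : ℝ) : 0 ≤ bridgeDensity s r x := by
  by_cases hx : x ∈ Set.Ioo (0 : ℝ) 1
  · rcases eq_or_lt_of_le (zero_le (a := s)) with rfl | hs
    · rw [bridgeDensity_zero_left]
    · exact (betaPDFReal_pos hx.1 hx.2 (by exact_mod_cast hs)
        (sub_pos.2 (by exact_mod_cast hsr))).le
  · rw [bridgeDensity_eq_zero hx]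

theorem bridgeDensity_le {s r : ℝ≥0} (hsr : s < r) {x : ℝ} (hx : x ∈ Set.Ioo (0 : ℝ) 1) :
    bridgeDensity s r x ≤ ((r : ℝ) - s) / (x * (1 - x)) := by
  have h1x : 0 < 1 - x := sub_pos.2 hx.2
  have hx0 := hx.1
  have hsr' : (s : ℝ) < r := by exact_mod_cast hsr
  have hb : 0 < (r : ℝ) - s := sub_pos.2 hsr'
  rcases eq_or_lt_of_le (zero_le (a := s)) with rfl | hs
  · rw [bridgeDensity_zero_left]; positivity
  have hs' : (0 : ℝ) < s := by exact_mod_cast hs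
  have hr' : (0 : ℝ) < r := hs'.trans hsr'
  refine (betaPDFReal_le hs' hb hx.1 hx.2).trans ?_
  rw [add_sub_cancel, div_le_div_iff₀ (by positivity) (by positivity)]
  nlinarith [mul_pos hb (mul_pos hx0 h1x)]

theorem bridgeDensity_le_const {s r : ℝ≥0} (hsr : s < r) {x : ℝ} (hx : x ∈ Set.Ioo (0 : ℝ) 1) :
    bridgeDensity s r x ≤ s / (x * (1 - x)) := by
  have h1x : 0 < 1 - x := sub_pos.2 hx.2
  have hx0 := hx.1
  have hsr' : (s : ℝ) < r := by exact_mod_cast hsr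
  have hb : 0 < (r : ℝ) - s := sub_pos.2 hsr'
  rcases eq_or_lt_of_le (zero_le (a := s)) with rfl | hs
  · rw [bridgeDensity_zero_left]; positivity
  have hs' : (0 : ℝ) < s := by exact_mod_cast hs
  have hr' : (0 : ℝ) < r := hs'.trans hsr'
  refine (betaPDFReal_le hs' hb hx.1 hx.2).trans ?_
  rw [add_sub_cancel, div_le_div_iff₀ (by positivity) (by positivity)]
  nlinarith [mul_pos (mul_pos hs' hs') (mul_pos hx0 h1x)]

theorem integrableOn_bridgeDensity (ν : Measure ℝ≥0) [IsProbabilityMeasure ν] (s : ℝ≥0) (x : ℝ) :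
    IntegrableOn (fun r => bridgeDensity s r x) (Set.Ioi s) ν := by
  by_cases hx : x ∈ Set.Ioo (0 : ℝ) 1
  · refine Integrable.of_bound (C := s / (x * (1 - x)))
      (measurable_bridgeDensity.comp (f := fun r => (s, r, x)) (by fun_prop)).aestronglyMeasurable
      (ae_restrict_of_forall_mem measurableSet_Ioi fun r hr => ?_)
    rw [Real.norm_of_nonneg (bridgeDensity_nonneg hr x)]
    exact bridgeDensity_le_const hr hx
  · simp only [bridgeDensity_eq_zero hx]
    exact integrableOn_zero

theorem integrableOn_inv_mul_bridgeDensity (ν : Measure ℝ≥0) [IsProbabilityMeasure ν]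
    (s : ℝ≥0) (x : ℝ) :
    IntegrableOn (fun r : ℝ≥0 => ((r : ℝ) - s)⁻¹ * bridgeDensity s r x) (Set.Ioi s) ν := by
  by_cases hx : x ∈ Set.Ioo (0 : ℝ) 1
  · have hm : Measurable (fun r => bridgeDensity s r x) :=
      measurable_bridgeDensity.comp (f := fun r => (s, r, x)) (by fun_prop)
    refine Integrable.of_bound (C := 1 / (x * (1 - x))) (by fun_prop)
      (ae_restrict_of_forall_mem measurableSet_Ioi fun r hr => ?_)
    have hb : 0 < (r : ℝ) - s := sub_pos.2 (by exact_mod_cast hr)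
    rw [Real.norm_of_nonneg (mul_nonneg (by positivity) (bridgeDensity_nonneg hr x)),
      inv_mul_le_iff₀ hb]
    refine (bridgeDensity_le hr hx).trans_eq ?_
    ring
  · simp only [bridgeDensity_eq_zero hx, mul_zero]
    exact integrableOn_zero

theorem integrableOn_inv_mul_bridgePhi (ν : Measure ℝ≥0) [IsProbabilityMeasure ν]
    (s : ℝ≥0) (x : ℝ) :
    IntegrableOn (fun r : ℝ≥0 => ((r : ℝ) - s)⁻¹ * bridgePhi ν s r x) (Set.Ioi s) ν := by
  simp only [bridgePhi, ← mul_div_assoc]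
  exact (integrableOn_inv_mul_bridgeDensity ν s x).div_const _

theorem bridgeDrift_eq (ν : Measure ℝ≥0) (s : ℝ≥0) (x : ℝ) :
    bridgeDrift ν s x = (1 - x) * (∫ r in Set.Ioi s, ((r : ℝ) - s)⁻¹ * bridgeDensity s r x ∂ν) /
      ∫ r in Set.Ioi s, bridgeDensity s r x ∂ν := by
  unfold bridgeDrift bridgePhi
  by_cases hx : x ∈ Set.Ioo (0 : ℝ) 1
  · rw [Set.indicator_of_mem hx]
    simp only [← mul_div_assoc]
    rw [integral_div, mul_div_assoc]
  · rw [Set.indicator_of_notMem hx]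
    simp [bridgeDensity_eq_zero hx]

theorem bridgeDrift_of_notMem (ν : Measure ℝ≥0) {s : ℝ≥0} {x : ℝ} (hx : x ∉ Set.Ioo (0 : ℝ) 1) :
    bridgeDrift ν s x = 0 :=
  Set.indicator_of_notMem hx _

theorem bridgeDrift_nonneg (ν : Measure ℝ≥0) (s : ℝ≥0) (x : ℝ) : 0 ≤ bridgeDrift ν s x := by
  by_cases hx : x ∈ Set.Ioo (0 : ℝ) 1
  · rw [bridgeDrift_eq]
    refine div_nonneg (mul_nonneg (sub_pos.2 hx.2).le ?_) ?_
    · refine setIntegral_nonneg measurableSet_Ioi fun r hr => mul_nonneg (inv_nonneg.2 ?_)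
        (bridgeDensity_nonneg hr x)
      exact sub_nonneg.2 (by exact_mod_cast (le_of_lt hr))
    · exact setIntegral_nonneg measurableSet_Ioi fun r hr => bridgeDensity_nonneg hr x
  · rw [bridgeDrift_of_notMem ν hx]

theorem setIntegral_Ioi_eq_integral_indicator (ν : Measure ℝ≥0) (g : ℝ≥0 → ℝ) (s : ℝ≥0) :
    ∫ r in Set.Ioi s, g r ∂ν = ∫ r, (if s < r then g r else 0) ∂ν := by
  rw [← integral_indicator measurableSet_Ioi]
  rfl

theorem measurable_bridgeDrift (ν : Measure ℝ≥0) [IsProbabilityMeasure ν] :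
    Measurable (fun p : ℝ≥0 × ℝ => bridgeDrift ν p.1 p.2) := by
  have hm : Measurable (fun q : (ℝ≥0 × ℝ) × ℝ≥0 => bridgeDensity q.1.1 q.2 q.1.2) :=
    measurable_bridgeDensity.comp
      (f := fun q : (ℝ≥0 × ℝ) × ℝ≥0 => (q.1.1, q.2, q.1.2)) (by fun_prop)
  have hlt : MeasurableSet {q : (ℝ≥0 × ℝ) × ℝ≥0 | q.1.1 < q.2} :=
    measurableSet_lt measurable_fst.fst measurable_snd
  have h1 : Measurable (fun p : ℝ≥0 × ℝ =>
      ∫ r, (if p.1 < r then ((r : ℝ) - p.1)⁻¹ * bridgeDensity p.1 r p.2 else 0) ∂ν) := by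
    refine (StronglyMeasurable.integral_prod_right' (f := fun q : (ℝ≥0 × ℝ) × ℝ≥0 =>
      if q.1.1 < q.2 then ((q.2 : ℝ) - q.1.1)⁻¹ * bridgeDensity q.1.1 q.2 q.1.2 else 0)
      (Measurable.stronglyMeasurable ?_)).measurable
    exact Measurable.ite hlt (by fun_prop) measurable_const
  have h2 : Measurable (fun p : ℝ≥0 × ℝ =>
      ∫ r, (if p.1 < r then bridgeDensity p.1 r p.2 else 0) ∂ν) := by
    refine (StronglyMeasurable.integral_prod_right' (f := fun q : (ℝ≥0 × ℝ) × ℝ≥0 =>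
      if q.1.1 < q.2 then bridgeDensity q.1.1 q.2 q.1.2 else 0)
      (Measurable.stronglyMeasurable ?_)).measurable
    exact Measurable.ite hlt (by fun_prop) measurable_const
  simp only [bridgeDrift_eq, setIntegral_Ioi_eq_integral_indicator]
  fun_prop

/-- The Bayes formula behind the drift: `bridgeDrift ν s x` is the mean of `(1 - x) / (r - s)` when
`r` has the posterior law, proportional to `bridgeDensity s r x` on `(s, ∞)`. The product form holds
also where the normalization vanishes. -/
theorem ofReal_bridgeDrift_mul_lintegral (ν : Measure ℝ≥0) [IsProbabilityMeasure ν]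
    (s : ℝ≥0) (x : ℝ) :
    ENNReal.ofReal (bridgeDrift ν s x) *
        ∫⁻ r in Set.Ioi s, ENNReal.ofReal (bridgeDensity s r x) ∂ν =
      ∫⁻ r in Set.Ioi s, ENNReal.ofReal ((1 - x) * ((r : ℝ) - s)⁻¹) *
        ENNReal.ofReal (bridgeDensity s r x) ∂ν := by
  by_cases hx : x ∈ Set.Ioo (0 : ℝ) 1
  swap
  · simp [bridgeDensity_eq_zero hx]
  have h1x : 0 < 1 - x := sub_pos.2 hx.2
  have hd : ∀ r ∈ Set.Ioi s, 0 ≤ bridgeDensity s r x := fun r hr => bridgeDensity_nonneg hr x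
  have hi : ∀ r ∈ Set.Ioi s, 0 ≤ ((r : ℝ) - s)⁻¹ := fun r hr =>
    inv_nonneg.2 (sub_nonneg.2 (by exact_mod_cast (le_of_lt hr)))
  have hR : ∫⁻ r in Set.Ioi s, ENNReal.ofReal ((1 - x) * ((r : ℝ) - s)⁻¹) *
        ENNReal.ofReal (bridgeDensity s r x) ∂ν =
      ENNReal.ofReal ((1 - x) * ∫ r in Set.Ioi s, ((r : ℝ) - s)⁻¹ * bridgeDensity s r x ∂ν) := by
    rw [← integral_const_mul, ofReal_integral_eq_lintegral_ofReal
      ((integrableOn_inv_mul_bridgeDensity ν s x).const_mul _)]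
    · refine setLIntegral_congr_fun measurableSet_Ioi fun r hr => ?_
      rw [← ENNReal.ofReal_mul (mul_nonneg h1x.le (hi r hr)), mul_assoc]
    · exact ae_restrict_of_forall_mem measurableSet_Ioi fun r hr =>
        mul_nonneg h1x.le (mul_nonneg (hi r hr) (hd r hr))
  have hL : ∫⁻ r in Set.Ioi s, ENNReal.ofReal (bridgeDensity s r x) ∂ν =
      ENNReal.ofReal (∫ r in Set.Ioi s, bridgeDensity s r x ∂ν) :=
    (ofReal_integral_eq_lintegral_ofReal (integrableOn_bridgeDensity ν s x)
      (ae_restrict_of_forall_mem measurableSet_Ioi hd)).symm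
  rw [hR, hL, ← ENNReal.ofReal_mul (bridgeDrift_nonneg ν s x), bridgeDrift_eq]
  congr 1
  rcases eq_or_ne (∫ r in Set.Ioi s, bridgeDensity s r x ∂ν) 0 with h0 | h0
  · have hz : (fun r => bridgeDensity s r x) =ᵐ[ν.restrict (Set.Ioi s)] 0 :=
      (setIntegral_eq_zero_iff_of_nonneg_ae (ae_restrict_of_forall_mem measurableSet_Ioi hd)
        (integrableOn_bridgeDensity ν s x)).1 h0
    have : ∫ r in Set.Ioi s, ((r : ℝ) - s)⁻¹ * bridgeDensity s r x ∂ν = 0 := by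
      refine integral_eq_zero_of_ae ?_
      filter_upwards [hz] with r hr
      rw [hr]
      simp
    rw [this, h0]
    simp
  · rw [div_mul_cancel₀ _ h0]

/-! ### Independence of the past and of the increments -/

theorem ProbabilityTheory.IndepFun.prodMk_right_of_prodMk_left {Ω α β δ : Type*}
    [MeasurableSpace Ω] [MeasurableSpace α] [MeasurableSpace β] [MeasurableSpace δ] {P : Measure Ω}
    [IsProbabilityMeasure P] {A : Ω → α} {B : Ω → β} {C : Ω → δ} (hA : Measurable A)
    (hB : Measurable B) (hC : Measurable C) (h : IndepFun (fun ω => (A ω, B ω)) C P)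
    (hAB : IndepFun A B P) : IndepFun A (fun ω => (B ω, C ω)) P := by
  have hBC : IndepFun B C P := h.comp (φ := Prod.snd) (ψ := id) measurable_snd measurable_id
  have h1 := (indepFun_iff_map_prod_eq_prod_map_map (hA.prodMk hB).aemeasurable hC.aemeasurable).1 h
  rw [(indepFun_iff_map_prod_eq_prod_map_map hA.aemeasurable hB.aemeasurable).1 hAB] at h1
  rw [indepFun_iff_map_prod_eq_prod_map_map hA.aemeasurable (hB.prodMk hC).aemeasurable,
    (indepFun_iff_map_prod_eq_prod_map_map hB.aemeasurable hC.aemeasurable).1 hBC]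
  have := Measure.isProbabilityMeasure_map (μ := P) hA.aemeasurable
  have := Measure.isProbabilityMeasure_map (μ := P) hB.aemeasurable
  have := Measure.isProbabilityMeasure_map (μ := P) hC.aemeasurable
  rw [← Measure.prodAssoc_prod, ← h1, Measure.map_map MeasurableEquiv.prodAssoc.measurable
    ((hA.prodMk hB).prodMk hC)]
  rfl

/-- The increments after time `s` of a process with independent increments are independent of its
past up to time `s`. -/
theorem ProbabilityTheory.HasIndepIncrements.indepFun_past {Ω : Type*} [MeasurableSpace Ω]
    {P : Measure Ω} [IsProbabilityMeasure P] {X : ℝ≥0 → Ω → ℝ} (hX : HasIndepIncrements X P)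
    (hm : ∀ t, Measurable (X t)) (h0 : ∀ᵐ ω ∂P, X 0 ω = 0) {s u r : ℝ≥0} (hsu : s ≤ u)
    (hur : u ≤ r) :
    IndepFun (fun ω v => X (min v s) ω) (fun ω => (X u ω - X s ω, X r ω - X u ω)) P := by
  refine IndepFun.process_indepFun (X := fun v ω => X (min v s) ω) (fun v => hm _)
    (((hm u).sub (hm s)).prodMk ((hm r).sub (hm u))) fun I => ?_
  -- The times `min v s` for `v ∈ I` are enumerated increasingly from `0` to `s`; then come `u`
  -- and `r`, and the past is a function of the increments between the first of these times.
  obtain ⟨t, m, ht, ht0, htm, htu, htr, htI⟩ : ∃ (t : ℕ → ℝ≥0) (m : ℕ), Monotone t ∧ t 0 = 0 ∧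
      t m = s ∧ t (m + 1) = u ∧ t (m + 2) = r ∧ ∀ i : I, ∃ k ≤ m, t k = min (i : ℝ≥0) s := by
    classical
    let J : Finset ℝ≥0 := insert 0 (insert s (I.image (min · s)))
    have hJs : ∀ x ∈ J, x ≤ s := by
      intro x hx
      simp only [J, Finset.mem_insert, Finset.mem_image] at hx
      rcases hx with rfl | rfl | ⟨v, _, rfl⟩
      · exact zero_le
      · exact le_rfl
      · exact min_le_right _ _
    obtain ⟨m, hmJ⟩ : ∃ m, J.card = m + 1 :=
      Nat.exists_eq_succ_of_ne_zero (Finset.card_ne_zero.2 ⟨0, by simp [J]⟩)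
    let f := J.orderEmbOfFin hmJ
    have hf : ∀ x ∈ J, ∃ k, f k = x := fun x hx => by
      have : x ∈ Set.range f := by rw [Finset.range_orderEmbOfFin]; exact hx
      exact this
    let t : ℕ → ℝ≥0 := fun n => if h : n < m + 1 then f ⟨n, h⟩ else if n = m + 1 then u else r
    have htf : ∀ k : Fin (m + 1), t k = f k := fun k => by
      simp only [t, dif_pos k.2]
    have hfs : ∀ k, f k ≤ s := fun k => hJs _ (Finset.orderEmbOfFin_mem _ _ _)
    refine ⟨t, m, monotone_nat_of_le_succ fun n => ?_, ?_, ?_, by simp [t], by simp [t], ?_⟩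
    · rcases lt_trichotomy n m with hn | rfl | hn
      · have h1 : n < m + 1 := by omega
        have h2 : n + 1 < m + 1 := by omega
        simp only [t, dif_pos h1, dif_pos h2]
        exact f.monotone (by simp)
      · simpa [t] using (hfs _).trans hsu
      · have h1 : ¬ n < m + 1 := by omega
        have h2 : ¬ n + 1 < m + 1 := by omega
        have h3 : n + 1 ≠ m + 1 := by omega
        simp only [t, dif_neg h1, dif_neg h2, if_neg h3]
        split_ifs
        · exact hur
        · exact le_rfl
    · obtain ⟨k, hk⟩ := hf 0 (by simp [J])
      have : f 0 ≤ f k := f.monotone (Fin.zero_le _)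
      rw [hk] at this
      have h2 := htf 0
      rw [Fin.val_zero] at h2
      rw [h2]
      exact le_antisymm this zero_le
    · obtain ⟨k, hk⟩ := hf s (by simp [J])
      have : f k ≤ f (Fin.last m) := f.monotone (Fin.le_last _)
      rw [hk] at this
      have h2 := htf (Fin.last m)
      rw [Fin.val_last] at h2
      rw [h2]
      exact le_antisymm (hfs _) this
    · intro i
      obtain ⟨k, hk⟩ := hf (min (i : ℝ≥0) s) (by
        simp only [J, Finset.mem_insert, Finset.mem_image]
        exact Or.inr (Or.inr ⟨i, i.2, rfl⟩))
      exact ⟨k, by omega, (htf k).trans hk⟩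
  choose k hkm hk using htI
  have hind := (hX.nat ht).indepFun_finset (Finset.range m) {m, m + 1} (by
    simp [Finset.disjoint_left]
    omega) (fun i => (hm _).sub (hm _))
  have hψ : Measurable (fun d : ({m, m + 1} : Finset ℕ) → ℝ =>
      (d ⟨m, by simp⟩, d ⟨m + 1, by simp⟩)) := by fun_prop
  have hcomp := hind.comp
    (φ := fun d (i : I) => ∑ j ∈ (Finset.range (k i)).attach,
      d ⟨j, Finset.mem_range.2 ((Finset.mem_range.1 j.2).trans_le (hkm i))⟩)
    (by fun_prop) hψ
  refine hcomp.congr ?_ ?_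
  · filter_upwards [h0] with ω hω
    funext i
    simp only [Function.comp]
    rw [Finset.sum_attach (Finset.range (k i)) (fun j => X (t (j + 1)) ω - X (t j) ω),
      Finset.sum_range_sub (fun j => X (t j) ω), ht0, hω, sub_zero, hk]
  · refine ae_of_all _ fun ω => ?_
    simp [htm, htu, htr]

section GammaProcess

variable {Ω : Type*} [mΩ : MeasurableSpace Ω] {P : Measure Ω} {γ : ℝ≥0 → Ω → ℝ}

theorem IsStandardGammaProcess.ae_nonneg (hγ : IsStandardGammaProcess γ P) :
    ∀ᵐ ω ∂P, ∀ t, 0 ≤ γ t ω := by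
  filter_upwards [hγ.zero, hγ.monotone] with ω h0 hm t
  rw [← h0]
  exact hm zero_le

theorem IsStandardGammaProcess.indepFun_sub (hγ : IsStandardGammaProcess γ P) {a u : ℝ≥0}
    (hau : a ≤ u) : IndepFun (γ a) (fun ω => γ u ω - γ a ω) P :=
  hγ.indepIncrements.indepFun_eval_sub zero_le hau hγ.zero

variable [IsProbabilityMeasure P]

theorem IsStandardGammaProcess.map_eq (hγ : IsStandardGammaProcess γ P) {t : ℝ≥0} (ht : 0 < t) :
    P.map (γ t) = gammaMeasure t 1 := by
  have := Measure.isProbabilityMeasure_map (μ := P) (hγ.measurable t).aemeasurable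
  refine eq_gammaMeasure_of_laplace (by exact_mod_cast ht) ?_ fun l hl => ?_
  · rw [ae_map_iff (hγ.measurable t).aemeasurable measurableSet_Ici]
    filter_upwards [hγ.ae_nonneg] with ω hω using hω t
  · rw [integral_map (hγ.measurable t).aemeasurable (by fun_prop), hγ.laplace t l hl]

theorem IsStandardGammaProcess.map_sub_eq (hγ : IsStandardGammaProcess γ P) {s u : ℝ≥0}
    (hsu : s < u) : P.map (fun ω => γ u ω - γ s ω) = gammaMeasure ((u : ℝ) - s) 1 := by
  have h := (hγ.stationaryIncrements s (u - s)).map_eq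
  rw [add_tsub_cancel_of_le hsu.le, hγ.map_eq (tsub_pos_of_lt hsu), NNReal.coe_sub hsu.le] at h
  exact h

theorem IsStandardGammaProcess.indepFun_past (hγ : IsStandardGammaProcess γ P) {s u r : ℝ≥0}
    (hsu : s ≤ u) (hur : u ≤ r) :
    IndepFun (fun ω v => γ (min v s) ω) (fun ω => (γ u ω - γ s ω, γ r ω - γ u ω)) P :=
  hγ.indepIncrements.indepFun_past hγ.measurable hγ.zero hsu hur

theorem IsStandardGammaProcess.ae_strictMono (hγ : IsStandardGammaProcess γ P) :
    ∀ᵐ ω ∂P, StrictMono (fun t => γ t ω) := by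
  have hpos : ∀ s u : ℝ≥0, s < u → ∀ᵐ ω ∂P, γ s ω < γ u ω := fun s u hsu => by
    have h := gammaMeasure_ae_pos ((u : ℝ) - s) 1
    have hm : Measurable (fun ω => γ u ω - γ s ω) := (hγ.measurable u).sub (hγ.measurable s)
    rw [← hγ.map_sub_eq hsu, ae_map_iff hm.aemeasurable measurableSet_Ioi] at h
    filter_upwards [h] with ω hω using sub_pos.1 hω
  obtain ⟨D, hDc, hDd⟩ := TopologicalSpace.exists_countable_dense ℝ≥0
  have hall : ∀ᵐ ω ∂P, ∀ s ∈ D, ∀ u ∈ D, s < u → γ s ω < γ u ω := by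
    rw [ae_ball_iff hDc]
    intro s _
    rw [ae_ball_iff hDc]
    intro u _
    exact eventually_imp_distrib_left.2 (hpos s u)
  filter_upwards [hall, hγ.monotone] with ω hω hm s u hsu
  obtain ⟨p, hpD, hsp, hpu⟩ := hDd.exists_between hsu
  obtain ⟨q, hqD, hpq, hqu⟩ := hDd.exists_between hpu
  exact (hm hsp.le).trans_lt ((hω p hpD q hqD hpq).trans_le (hm hqu.le))

/-! ### Gamma laws and independence of ratios -/

theorem map_div_add_prodMk_of_gamma {A B : Ω → ℝ} {a b : ℝ} (hA : Measurable A)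
    (hB : Measurable B) (ha : 0 < a) (hb : 0 < b) (hAlaw : P.map A = gammaMeasure a 1)
    (hBlaw : P.map B = gammaMeasure b 1) (h : IndepFun A B P) :
    P.map (fun ω => (A ω / (A ω + B ω), A ω + B ω)) =
      (betaMeasure a b).prod (gammaMeasure (a + b) 1) := by
  rw [← map_div_add_gammaMeasure_prod ha hb, ← hAlaw, ← hBlaw,
    ← (indepFun_iff_map_prod_eq_prod_map_map hA.aemeasurable hB.aemeasurable).1 h,
    Measure.map_map (by fun_prop) (hA.prodMk hB)]
  rfl

theorem map_div_add_of_gamma {A B : Ω → ℝ} {a b : ℝ} (hA : Measurable A)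
    (hB : Measurable B) (ha : 0 < a) (hb : 0 < b) (hAlaw : P.map A = gammaMeasure a 1)
    (hBlaw : P.map B = gammaMeasure b 1) (h : IndepFun A B P) :
    P.map (fun ω => A ω / (A ω + B ω)) = betaMeasure a b := by
  have h1 := congrArg (Measure.map Prod.fst)
    (map_div_add_prodMk_of_gamma hA hB ha hb hAlaw hBlaw h)
  have := isProbabilityMeasure_gammaMeasure (add_pos ha hb) one_pos
  have := isProbabilityMeasureBeta ha hb
  rw [Measure.map_map measurable_fst (by fun_prop)] at h1
  simpa [Function.comp_def] using h1

theorem indepFun_div_add_of_gamma {A B : Ω → ℝ} {a b : ℝ} (hA : Measurable A)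
    (hB : Measurable B) (ha : 0 < a) (hb : 0 < b) (hAlaw : P.map A = gammaMeasure a 1)
    (hBlaw : P.map B = gammaMeasure b 1) (h : IndepFun A B P) :
    IndepFun (fun ω => A ω / (A ω + B ω)) (fun ω => A ω + B ω) P := by
  have h1 := map_div_add_prodMk_of_gamma hA hB ha hb hAlaw hBlaw h
  have h2 := congrArg (Measure.map Prod.snd) h1
  have := isProbabilityMeasure_gammaMeasure (add_pos ha hb) one_pos
  have := isProbabilityMeasureBeta ha hb
  rw [Measure.map_map measurable_snd (by fun_prop)] at h2
  rw [indepFun_iff_map_prod_eq_prod_map_map (by fun_prop) (by fun_prop), h1,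
    map_div_add_of_gamma hA hB ha hb hAlaw hBlaw h]
  congr 1
  simpa [Function.comp_def] using h2.symm

theorem IsStandardGammaProcess.map_div (hγ : IsStandardGammaProcess γ P) {a u : ℝ≥0}
    (ha : 0 < a) (hau : a < u) :
    P.map (fun ω => γ a ω / γ u ω) = betaMeasure a ((u : ℝ) - a) := by
  have h := map_div_add_of_gamma (hγ.measurable a) ((hγ.measurable u).sub (hγ.measurable a))
    (NNReal.coe_pos.2 ha) (sub_pos.2 (NNReal.coe_lt_coe.2 hau)) (hγ.map_eq ha)
    (hγ.map_sub_eq hau) (hγ.indepFun_sub hau.le)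
  simpa using h

theorem IsStandardGammaProcess.indepFun_div (hγ : IsStandardGammaProcess γ P) {a u : ℝ≥0}
    (hau : a ≤ u) : IndepFun (fun ω => γ a ω / γ u ω) (γ u) P := by
  rcases eq_or_lt_of_le (zero_le (a := a)) with rfl | ha
  · refine (indepFun_const_left (0 : ℝ) (γ u)).congr ?_ .rfl
    filter_upwards [hγ.zero] with ω hω
    simp [hω]
  rcases eq_or_lt_of_le hau with rfl | hau'
  · refine (indepFun_const_left (1 : ℝ) (γ a)).congr ?_ .rfl
    filter_upwards [hγ.zero, hγ.ae_strictMono] with ω hω hs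
    have := hs ha
    simp only [hω] at this
    rw [div_self this.ne']
  have h := indepFun_div_add_of_gamma (hγ.measurable a) ((hγ.measurable u).sub (hγ.measurable a))
    (NNReal.coe_pos.2 ha) (sub_pos.2 (NNReal.coe_lt_coe.2 hau')) (hγ.map_eq ha)
    (hγ.map_sub_eq hau') (hγ.indepFun_sub hau)
  simpa using h

/-- By induction on the set of times: the ratios for times below the largest one `a` are independent
of the pair formed by `γ_a` and the increment after `a`, and `γ_a / γ_u` is independent of `γ_u`. -/
theorem IsStandardGammaProcess.indepFun_finset_div (hγ : IsStandardGammaProcess γ P)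
    (T : Finset ℝ≥0) : ∀ u : ℝ≥0, (∀ v ∈ T, v ≤ u) →
      IndepFun (fun ω (i : T) => γ i ω / γ u ω) (γ u) P := by
  induction T using Finset.induction_on_max with
  | empty =>
    intro u _
    have : (fun ω (i : (∅ : Finset ℝ≥0)) => γ i ω / γ u ω) = fun _ _ => 0 := by
      funext ω i
      exact absurd i.2 (Finset.notMem_empty _)
    rw [this]
    exact indepFun_const_left _ _
  | insert a T hT ih =>
    intro u hu
    have hau : a ≤ u := hu a (by simp)
    have hm := hγ.measurable
    have hD : Measurable (fun ω (i : T) => γ i ω / γ a ω) :=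
      measurable_pi_lambda _ fun i => (hm i).div (hm a)
    have h1 : IndepFun (fun ω => ((fun (i : T) => γ i ω / γ a ω), γ a ω))
        (fun ω => γ u ω - γ a ω) P := by
      have := (hγ.indepFun_past le_rfl hau).comp
        (φ := fun w : ℝ≥0 → ℝ => ((fun (i : T) => w i / w a), w a)) (ψ := Prod.snd)
        (by fun_prop) measurable_snd
      refine this.congr (ae_of_all _ fun ω => ?_) .rfl
      simp only [Function.comp, min_self]
      congr 1
      funext i
      rw [min_eq_left (hT i i.2).le]
    have h2 := (IndepFun.prodMk_right_of_prodMk_left hD (hm a) ((hm u).sub (hm a)) h1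
      (ih a fun v hv => (hT v hv).le)).comp (φ := id)
        (ψ := fun p : ℝ × ℝ => (p.1 + p.2, p.1 / (p.1 + p.2))) measurable_id (by fun_prop)
    have h3 : IndepFun (fun ω => (γ u ω, γ a ω / γ u ω)) (fun ω (i : T) => γ i ω / γ a ω) P := by
      refine h2.symm.congr (ae_of_all _ fun ω => ?_) .rfl
      simp
    have h4 : IndepFun (fun ω => (γ a ω / γ u ω, fun (i : T) => γ i ω / γ a ω)) (γ u) P :=
      (IndepFun.prodMk_right_of_prodMk_left (hm u) ((hm a).div (hm u)) hD h3
      (hγ.indepFun_div hau).symm).symm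
    have h5 := h4.comp (φ := fun p : ℝ × (T → ℝ) => fun (i : (insert a T : Finset ℝ≥0)) =>
      if h : (i : ℝ≥0) ∈ T then p.2 ⟨i, h⟩ * p.1 else p.1) (ψ := id) (by
        refine measurable_pi_lambda _ fun i => ?_
        split_ifs <;> fun_prop) measurable_id
    refine h5.congr ?_ .rfl
    filter_upwards [hγ.ae_nonneg, hγ.monotone] with ω h0 hmono
    funext i
    simp only [Function.comp]
    split_ifs with hi
    · rcases eq_or_ne (γ a ω) 0 with ha0 | ha0
      · have : γ i ω = 0 := le_antisymm (ha0 ▸ hmono (hT i hi).le) (h0 i)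
        simp [this]
      · rw [div_mul_div_cancel₀ ha0]
    · have : (i : ℝ≥0) = a := (Finset.mem_insert.1 i.2).resolve_right hi
      rw [this]

/-- The gamma process up to time `u`, normalized by its value at `u`, is independent of that
value. -/
theorem IsStandardGammaProcess.indepFun_normalized (hγ : IsStandardGammaProcess γ P) (u : ℝ≥0) :
    IndepFun (fun ω v => γ (min v u) ω / γ u ω) (γ u) P := by
  classical
  refine IndepFun.process_indepFun (X := fun v ω => γ (min v u) ω / γ u ω)
    (fun v => (hγ.measurable _).div (hγ.measurable _)) (hγ.measurable u) fun I => ?_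
  have h := hγ.indepFun_finset_div (I.image (min · u)) u (by simp)
  exact h.comp (φ := fun d (i : I) => d ⟨min (i : ℝ≥0) u, Finset.mem_image_of_mem _ i.2⟩) (ψ := id)
    (by fun_prop) measurable_id

theorem IsStandardGammaProcess.indepFun_normalized_div (hγ : IsStandardGammaProcess γ P)
    {u r : ℝ≥0} (hur : u ≤ r) :
    IndepFun (fun ω => γ u ω / γ r ω) (fun ω v => γ (min v u) ω / γ u ω) P := by
  have hm := hγ.measurable
  have hD : Measurable (fun ω v => γ (min v u) ω / γ u ω) :=
    measurable_pi_lambda _ fun v => (hm _).div (hm u)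
  have h1 : IndepFun (fun ω => ((fun v => γ (min v u) ω / γ u ω), γ u ω))
      (fun ω => γ r ω - γ u ω) P := by
    have := (hγ.indepFun_past le_rfl hur).comp
      (φ := fun w : ℝ≥0 → ℝ => ((fun v => w v / w u), w u)) (ψ := Prod.snd)
      (by fun_prop) measurable_snd
    simpa [Function.comp_def] using this
  have h2 := (IndepFun.prodMk_right_of_prodMk_left hD (hm u) ((hm r).sub (hm u)) h1
    (hγ.indepFun_normalized u)).comp (φ := id)
      (ψ := fun p : ℝ × ℝ => p.1 / (p.1 + p.2)) measurable_id (by fun_prop)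
  simpa [Function.comp_def] using h2.symm

/-! ### The bridge of deterministic length -/

/-- Given `ζ^r_u = x`, the bridge of length `r` on `[0, u]` is `x` times a gamma bridge of length
`u`, whatever `r` is. This is why the current value of the bridge is all that its past tells about
its length. -/
theorem IsStandardGammaProcess.lintegral_gammaBridge_past (hγ : IsStandardGammaProcess γ P)
    {u r : ℝ≥0} (hu : 0 < u) (hur : u < r) {G : (ℝ≥0 → ℝ) → ℝ≥0∞} (hG : Measurable G) :
    ∫⁻ ω, G (fun v => gammaBridge γ r (min v u) ω) ∂P =
      ∫⁻ x, ∫⁻ ω, G (fun v => x * (γ (min v u) ω / γ u ω)) ∂P ∂betaMeasure u ((r : ℝ) - u) := by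
  have hm := hγ.measurable
  have hD : Measurable (fun ω v => γ (min v u) ω / γ u ω) :=
    measurable_pi_lambda _ fun v => (hm _).div (hm u)
  have hX : Measurable (fun ω => γ u ω / γ r ω) := (hm u).div (hm r)
  have hF : Measurable (fun p : ℝ × (ℝ≥0 → ℝ) => G (fun v => p.1 * p.2 v)) :=
    hG.comp (by fun_prop)
  have hlaw := (indepFun_iff_map_prod_eq_prod_map_map hX.aemeasurable hD.aemeasurable).1
    (hγ.indepFun_normalized_div hur.le)
  rw [hγ.map_div hu hur] at hlaw
  have := isProbabilityMeasureBeta (NNReal.coe_pos.2 hu) (sub_pos.2 (NNReal.coe_lt_coe.2 hur))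
  have hinner : ∀ x, ∫⁻ ω, G (fun v => x * (γ (min v u) ω / γ u ω)) ∂P =
      ∫⁻ d, G (fun v => x * d v) ∂P.map (fun ω v => γ (min v u) ω / γ u ω) := fun x => by
    have hGx : Measurable (fun d : ℝ≥0 → ℝ => G (fun v => x * d v)) := hG.comp (by fun_prop)
    rw [lintegral_map hGx hD]
  simp only [hinner]
  rw [← lintegral_prod _ hF.aemeasurable, ← hlaw, lintegral_map hF (hX.prodMk hD)]
  refine lintegral_congr_ae ?_
  filter_upwards [hγ.zero, hγ.ae_strictMono] with ω h0 hs
  have hu0 := hs hu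
  simp only [h0] at hu0
  congr 1
  funext v
  rw [gammaBridge, min_eq_left ((min_le_right v u).trans hur.le), mul_comm,
    div_mul_div_cancel₀ hu0.ne']

/-- For the bridge of length `r`, the process `(1 - ζ^r_u) / (r - u)` is a martingale. -/
theorem IsStandardGammaProcess.lintegral_one_sub_gammaBridge (hγ : IsStandardGammaProcess γ P)
    {s u r : ℝ≥0} (hsu : s ≤ u) (hur : u < r) {H : (ℝ≥0 → ℝ) → ℝ≥0∞} (hH : Measurable H) :
    ∫⁻ ω, ENNReal.ofReal (1 - gammaBridge γ r u ω) *
        H (fun v => gammaBridge γ r (min v s) ω) ∂P =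
      ENNReal.ofReal (((r : ℝ) - u) / (r - s)) *
        ∫⁻ ω, ENNReal.ofReal (1 - gammaBridge γ r s ω) *
          H (fun v => gammaBridge γ r (min v s) ω) ∂P := by
  have hm := hγ.measurable
  have hur' : (u : ℝ) < r := NNReal.coe_lt_coe.2 hur
  rcases eq_or_lt_of_le hsu with rfl | hsu
  · rw [div_self (sub_pos.2 hur').ne']
    simp
  have hsu' : (s : ℝ) < u := NNReal.coe_lt_coe.2 hsu
  have hind := hγ.indepFun_past hsu.le hur.le
  have hab := hγ.indepIncrements.indepFun_sub_sub hsu.le hur.le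
  set a : Ω → ℝ := fun ω => γ u ω - γ s ω with ha
  set b : Ω → ℝ := fun ω => γ r ω - γ u ω with hb
  have ham : Measurable a := (hm u).sub (hm s)
  have hbm : Measurable b := (hm r).sub (hm u)
  have hpm : Measurable (fun ω v => γ (min v s) ω) := measurable_pi_lambda _ fun v => hm _
  -- `1 - ζ^r_u` is `(1 - Y) (1 - ζ^r_s)`, where `Y` is independent of `γ_r` and of the past of `s`.
  set Y : Ω → ℝ := fun ω => a ω / (a ω + b ω) with hY
  have hYm : Measurable Y := by fun_prop
  have hYlaw : P.map Y = betaMeasure ((u : ℝ) - s) ((r : ℝ) - u) :=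
    map_div_add_of_gamma ham hbm (sub_pos.2 hsu') (sub_pos.2 hur')
      (hγ.map_sub_eq hsu) (hγ.map_sub_eq hur) hab
  have hYS : IndepFun Y (fun ω => a ω + b ω) P :=
    indepFun_div_add_of_gamma ham hbm (sub_pos.2 hsu') (sub_pos.2 hur')
      (hγ.map_sub_eq hsu) (hγ.map_sub_eq hur) hab
  have hYSp : IndepFun Y (fun ω => (a ω + b ω, fun v => γ (min v s) ω)) P := by
    refine IndepFun.prodMk_right_of_prodMk_left hYm (ham.add hbm) hpm ?_ hYS
    exact (hind.comp (φ := id) (ψ := fun p : ℝ × ℝ => (p.1 / (p.1 + p.2), p.1 + p.2))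
      measurable_id (by fun_prop)).symm
  have hprod := hYSp.comp (φ := fun y => ENNReal.ofReal (1 - y))
    (ψ := fun p : ℝ × (ℝ≥0 → ℝ) => ENNReal.ofReal (1 - p.2 s / (p.2 s + p.1)) *
      H (fun v => p.2 v / (p.2 s + p.1))) (by fun_prop)
      (Measurable.mul (by fun_prop) (hH.comp (by fun_prop)))
  have hψm : Measurable (fun p : ℝ × (ℝ≥0 → ℝ) => ENNReal.ofReal (1 - p.2 s / (p.2 s + p.1)) *
      H (fun v => p.2 v / (p.2 s + p.1))) :=
    Measurable.mul (by fun_prop) (hH.comp (by fun_prop))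
  have hmean : ∫⁻ ω, ENNReal.ofReal (1 - Y ω) ∂P = ENNReal.ofReal (((r : ℝ) - u) / (r - s)) := by
    rw [← lintegral_map (f := fun y => ENNReal.ofReal (1 - y)) (by fun_prop) hYm, hYlaw,
      lintegral_one_sub_betaMeasure (sub_pos.2 hsu') (sub_pos.2 hur')]
    congr 2
    ring
  have hS : ∀ ω, γ s ω + (a ω + b ω) = γ r ω := fun ω => by simp only [ha, hb]; ring
  have hbr : ∀ v ω, gammaBridge γ r (min v s) ω = γ (min v s) ω / γ r ω := fun v ω => by
    rw [gammaBridge, min_eq_left ((min_le_right v s).trans (hsu.trans hur).le)]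
  have hbs : ∀ ω, gammaBridge γ r s ω = γ s ω / γ r ω := fun ω => by
    rw [gammaBridge, min_eq_left (hsu.trans hur).le]
  have hSm : Measurable (fun ω => a ω + b ω) := ham.add hbm
  have hYm' : Measurable (fun ω => ENNReal.ofReal (1 - Y ω)) := by fun_prop
  have hkey := lintegral_mul_eq_lintegral_mul_lintegral_of_indepFun'' hYm'.aemeasurable
    (hψm.comp (hSm.prodMk hpm)).aemeasurable hprod
  simp only [Function.comp, min_self, hS, hmean] at hkey
  simp only [hbr, hbs]
  rw [← hkey]
  refine lintegral_congr_ae ?_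
  filter_upwards [hγ.ae_strictMono, hγ.ae_nonneg] with ω hs h0
  have h1 : γ s ω < γ u ω := hs hsu
  have h2 : γ u ω < γ r ω := hs hur
  have hr0 : γ r ω ≠ 0 := ((h0 s).trans_lt (h1.trans h2)).ne'
  have hab0 : a ω + b ω ≠ 0 := by
    simp only [ha, hb]
    linarith
  rw [← mul_assoc, ← ENNReal.ofReal_mul]
  · congr 2
    rw [gammaBridge, min_eq_left hur.le]
    simp only [hY]
    have e : γ r ω = γ s ω + (a ω + b ω) := (hS ω).symm
    have e2 : γ u ω = γ s ω + a ω := by simp only [ha]; ring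
    rw [one_sub_div hr0, one_sub_div hab0, one_sub_div hr0, div_mul_div_comm, div_eq_div_iff hr0
      (mul_ne_zero hab0 hr0), e2, e]
    ring
  · simp only [hY]
    rw [one_sub_div hab0]
    refine div_nonneg ?_ ?_ <;> simp only [ha, hb] <;> linarith

end GammaProcess

/-! ### Evaluation of right-continuous paths -/

/-- The first point of the grid `{k / (n + 1)}` that lies strictly to the right of `x`. -/
noncomputable def rightGrid (n : ℕ) (x : ℝ≥0) : ℝ≥0 := ((⌊x * (n + 1)⌋₊ : ℝ≥0) + 1) / (n + 1)

theorem lt_rightGrid (n : ℕ) (x : ℝ≥0) : x < rightGrid n x := by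
  rw [rightGrid, lt_div_iff₀ (by positivity)]
  exact Nat.lt_floor_add_one _

theorem rightGrid_le (n : ℕ) (x : ℝ≥0) : rightGrid n x ≤ x + 1 / (n + 1) := by
  have hn : (0 : ℝ≥0) < n + 1 := by positivity
  rw [rightGrid, div_le_iff₀ hn, add_mul, one_div, inv_mul_cancel₀ hn.ne']
  exact add_le_add (Nat.floor_le (by positivity)) le_rfl

theorem tendsto_rightGrid (x : ℝ≥0) : Tendsto (fun n => rightGrid n x) atTop (𝓝[≥] x) := by
  refine tendsto_nhdsWithin_iff.2 ⟨?_, Eventually.of_forall fun n => (lt_rightGrid n x).le⟩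
  have h1 : Tendsto (fun n : ℕ => x + 1 / ((n : ℝ≥0) + 1)) atTop (𝓝 (x + 0)) :=
    tendsto_const_nhds.add tendsto_one_div_add_atTop_nhds_zero_nat
  rw [add_zero] at h1
  exact tendsto_of_tendsto_of_tendsto_of_le_of_le tendsto_const_nhds h1
    (fun n => (lt_rightGrid n x).le) (fun n => rightGrid_le n x)

/-- Reading off a process at a grid point is jointly measurable in time and randomness, since the
grid is countable. -/
theorem measurable_comp_rightGrid {α : Type*} [MeasurableSpace α] {Y : ℝ≥0 → α → ℝ}
    (hY : ∀ t, Measurable (Y t)) (n : ℕ) :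
    Measurable (fun p : ℝ≥0 × α => Y (rightGrid n p.1) p.2) := by
  obtain ⟨e, he⟩ : ∃ e : ℕ → ℝ≥0, ∀ k, e k = ((k : ℝ≥0) + 1) / (n + 1) := ⟨_, fun _ => rfl⟩
  have h1 : Measurable (fun p : ℕ × α => Y (e p.1) p.2) :=
    measurable_from_prod_countable_right (fun k => hY (e k))
  have h2 : Measurable (fun p : ℝ≥0 × α => (⌊p.1 * (n + 1)⌋₊, p.2)) :=
    (Nat.measurable_floor.comp (measurable_fst.mul_const _)).prodMk measurable_snd
  simp only [rightGrid, ← he]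
  exact h1.comp h2

theorem measurable_uncurry_of_rightContinuous {α : Type*} [MeasurableSpace α] {Y : ℝ≥0 → α → ℝ}
    (hY : ∀ t, Measurable (Y t)) (hc : ∀ ω t, ContinuousWithinAt (fun t => Y t ω) (Set.Ici t) t) :
    Measurable (fun p : ℝ≥0 × α => Y p.1 p.2) :=
  measurable_of_tendsto_metrizable (fun n => measurable_comp_rightGrid hY n)
    (tendsto_pi_nhds.2 fun p => (hc p.2 p.1).tendsto.comp (tendsto_rightGrid p.1))

/-- A jointly measurable substitute for the evaluation `(t, w) ↦ w t`, which is not measurable on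
the space of all paths. The two agree where `w` is right-continuous. -/
noncomputable def pathEval (t : ℝ≥0) (w : ℝ≥0 → ℝ) : ℝ :=
  limsup (fun n => w (rightGrid n t)) atTop

theorem measurable_pathEval : Measurable (fun p : ℝ≥0 × (ℝ≥0 → ℝ) => pathEval p.1 p.2) :=
  Measurable.limsup fun n =>
    measurable_comp_rightGrid (Y := fun t (w : ℝ≥0 → ℝ) => w t) (fun t => measurable_pi_apply t) n

theorem pathEval_eq {t : ℝ≥0} {w : ℝ≥0 → ℝ} (hw : ContinuousWithinAt w (Set.Ici t) t) :
    pathEval t w = w t :=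
  (hw.tendsto.comp (tendsto_rightGrid t)).limsup_eq

/-- The gamma bridge of length `r` at time `t`, as a jointly measurable functional of the path of
the gamma process. -/
noncomputable def pathBridge (t r : ℝ≥0) (w : ℝ≥0 → ℝ) : ℝ :=
  pathEval (min t r) w / pathEval r w

theorem measurable_pathBridge :
    Measurable (fun p : ℝ≥0 × ℝ≥0 × (ℝ≥0 → ℝ) => pathBridge p.1 p.2.1 p.2.2) :=
  (measurable_pathEval.comp (f := fun p : ℝ≥0 × ℝ≥0 × (ℝ≥0 → ℝ) => (min p.1 p.2.1, p.2.2))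
    (by fun_prop)).div
    (measurable_pathEval.comp (f := fun p : ℝ≥0 × ℝ≥0 × (ℝ≥0 → ℝ) => (p.2.1, p.2.2)) (by fun_prop))

/-! ### The bridge of random length -/

theorem pathBridge_eq_gammaBridge {Ω : Type*} {γ : ℝ≥0 → Ω → ℝ} {ω : Ω}
    (h : IsCadlag (fun t => γ t ω)) (t r : ℝ≥0) :
    pathBridge t r (fun t => γ t ω) = gammaBridge γ r t ω := by
  rw [pathBridge, pathEval_eq (h _).1, pathEval_eq (h _).1, gammaBridge]

theorem gammaBridge_of_le {Ω : Type*} {γ : ℝ≥0 → Ω → ℝ} {r t : ℝ≥0} (h : r ≤ t) (ω : Ω) :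
    gammaBridge γ r t ω = γ r ω / γ r ω := by
  rw [gammaBridge, min_eq_right h]

theorem gammaBridge_nonneg {Ω : Type*} {γ : ℝ≥0 → Ω → ℝ} {ω : Ω} (h0 : γ 0 ω = 0)
    (hs : StrictMono (fun t => γ t ω)) (r t : ℝ≥0) : 0 ≤ gammaBridge γ r t ω :=
  div_nonneg (h0 ▸ hs.monotone zero_le) (h0 ▸ hs.monotone zero_le)

section RandomLength

variable {Ω : Type*} [mΩ : MeasurableSpace Ω] {P : Measure Ω} {γ : ℝ≥0 → Ω → ℝ}

theorem measurable_pathBridge_comp (hγ : IsStandardGammaProcess γ P) {τ : Ω → ℝ≥0}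
    (hτ : Measurable τ) :
    Measurable (fun p : ℝ≥0 × Ω => pathBridge p.1 (τ p.2) (fun t => γ t p.2)) := by
  have hm := hγ.measurable
  exact measurable_pathBridge.comp
    (f := fun p : ℝ≥0 × Ω => (p.1, τ p.2, fun t => γ t p.2)) (by fun_prop)

/-- The bridge has a jointly measurable version, as Fubini's theorem requires: joint measurability
of the bridge itself is not clear, because its paths are regular only almost surely. -/
theorem exists_measurable_version (hγ : IsStandardGammaProcess γ P) {τ : Ω → ℝ≥0}
    (hτ : Measurable τ) : ∃ Z : ℝ≥0 → Ω → ℝ, Measurable (fun p : ℝ≥0 × Ω => Z p.1 p.2) ∧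
      ∀ᵐ ω ∂P, ∀ v, randomGammaBridge γ τ v ω = Z v ω := by
  refine ⟨fun v ω => pathBridge v (τ ω) (fun t => γ t ω), measurable_pathBridge_comp hγ hτ, ?_⟩
  filter_upwards [hγ.cadlag] with ω hω v
  rw [pathBridge_eq_gammaBridge hω, randomGammaBridge]

variable [IsProbabilityMeasure P]

theorem measurable_lintegral_gammaBridge (hγ : IsStandardGammaProcess γ P)
    {F : ℝ≥0 × (ℝ≥0 → ℝ) → ℝ≥0∞} (hF : Measurable F) :
    Measurable (fun r => ∫⁻ ω, F (r, fun v => gammaBridge γ r v ω) ∂P) := by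
  have hm := hγ.measurable
  have hF' : Measurable (fun p : ℝ≥0 × (ℝ≥0 → ℝ) => F (p.1, fun v => pathBridge v p.1 p.2)) := by
    refine hF.comp (measurable_fst.prodMk (measurable_pi_lambda _ fun v => ?_))
    exact measurable_pathBridge.comp (f := fun p : ℝ≥0 × (ℝ≥0 → ℝ) => (v, p.1, p.2)) (by fun_prop)
  have h := Measurable.lintegral_prod_right' (ν := P)
    (hF'.comp (f := fun p : ℝ≥0 × Ω => (p.1, fun v => γ v p.2)) (by fun_prop))
  convert h using 2 with r
  refine lintegral_congr_ae ?_
  filter_upwards [hγ.cadlag] with ω hω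
  simp only [Function.comp, pathBridge_eq_gammaBridge hω]

/-- Conditioning on the independent length. -/
theorem lintegral_randomGammaBridge (hγ : IsStandardGammaProcess γ P) {τ : Ω → ℝ≥0}
    (hτ : Measurable τ) (hind : IndepFun τ (fun (ω : Ω) (t : ℝ≥0) => γ t ω) P)
    {F : ℝ≥0 × (ℝ≥0 → ℝ) → ℝ≥0∞} (hF : Measurable F) :
    ∫⁻ ω, F (τ ω, fun v => randomGammaBridge γ τ v ω) ∂P =
      ∫⁻ r, ∫⁻ ω, F (r, fun v => gammaBridge γ r v ω) ∂P ∂P.map τ := by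
  have hm : Measurable (fun ω v => γ v ω) := measurable_pi_lambda _ hγ.measurable
  have hF' : Measurable (fun p : ℝ≥0 × (ℝ≥0 → ℝ) => F (p.1, fun v => pathBridge v p.1 p.2)) := by
    refine hF.comp (measurable_fst.prodMk (measurable_pi_lambda _ fun v => ?_))
    exact measurable_pathBridge.comp (f := fun p : ℝ≥0 × (ℝ≥0 → ℝ) => (v, p.1, p.2)) (by fun_prop)
  have hlaw := (indepFun_iff_map_prod_eq_prod_map_map hτ.aemeasurable hm.aemeasurable).1 hind
  have := Measure.isProbabilityMeasure_map (μ := P) hτ.aemeasurable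
  have := Measure.isProbabilityMeasure_map (μ := P) hm.aemeasurable
  have h1 : ∫⁻ ω, F (τ ω, fun v => randomGammaBridge γ τ v ω) ∂P =
      ∫⁻ ω, F (τ ω, fun v => pathBridge v (τ ω) (fun t => γ t ω)) ∂P := by
    refine lintegral_congr_ae ?_
    filter_upwards [hγ.cadlag] with ω hω
    simp only [randomGammaBridge, pathBridge_eq_gammaBridge hω]
  rw [h1, ← lintegral_map (f := fun p : ℝ≥0 × (ℝ≥0 → ℝ) => F (p.1, fun v => pathBridge v p.1 p.2))
    hF' (hτ.prodMk hm), hlaw, lintegral_prod _ hF'.aemeasurable]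
  refine lintegral_congr fun r => ?_
  have hFr : Measurable (fun w => F (r, fun v => pathBridge v r w)) :=
    hF'.comp measurable_prodMk_left
  rw [lintegral_map hFr hm]
  refine lintegral_congr_ae ?_
  filter_upwards [hγ.cadlag] with ω hω
  simp only [pathBridge_eq_gammaBridge hω]

/-- The joint law of length, current value and past of the bridge on `{u < τ}`: the past enters only
through a weight `h x` which depends on the current value `x` and not on the length. -/
theorem lintegral_gammaBridge_past_lintegral (hγ : IsStandardGammaProcess γ P) (ν : Measure ℝ≥0)
    [IsProbabilityMeasure ν] {u : ℝ≥0} (hu : 0 < u) {g : ℝ≥0 × ℝ → ℝ≥0∞} (hg : Measurable g)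
    {G : (ℝ≥0 → ℝ) → ℝ≥0∞} (hG : Measurable G) :
    ∫⁻ r in Set.Ioi u, ∫⁻ ω, g (r, gammaBridge γ r u ω) *
        G (fun v => gammaBridge γ r (min v u) ω) ∂P ∂ν =
      ∫⁻ x, (∫⁻ ω, G (fun v => x * (γ (min v u) ω / γ u ω)) ∂P) *
        ∫⁻ r in Set.Ioi u, g (r, x) * ENNReal.ofReal (bridgeDensity u r x) ∂ν := by
  have hGm : Measurable (fun p : ℝ × Ω => G (fun v => p.1 * (γ (min v u) p.2 / γ u p.2))) := by
    have hm := hγ.measurable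
    exact hG.comp (by fun_prop)
  have hh : Measurable (fun x : ℝ => ∫⁻ ω, G (fun v => x * (γ (min v u) ω / γ u ω)) ∂P) :=
    hGm.lintegral_prod_right'
  have hd : Measurable (fun p : ℝ≥0 × ℝ => ENNReal.ofReal (bridgeDensity u p.1 p.2)) :=
    (measurable_bridgeDensity.comp (f := fun p : ℝ≥0 × ℝ => (u, p.1, p.2))
      (by fun_prop)).ennreal_ofReal
  have h1 : ∀ r ∈ Set.Ioi u, ∫⁻ ω, g (r, gammaBridge γ r u ω) *
        G (fun v => gammaBridge γ r (min v u) ω) ∂P =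
      ∫⁻ x, ENNReal.ofReal (bridgeDensity u r x) *
        (g (r, x) * ∫⁻ ω, G (fun v => x * (γ (min v u) ω / γ u ω)) ∂P) := by
    intro r hr
    have hgr : Measurable (fun x => g (r, x)) := by fun_prop
    have h := hγ.lintegral_gammaBridge_past hu hr (G := fun w => g (r, w u) * G w) (by fun_prop)
    simp only [min_self] at h
    rw [h, betaMeasure, lintegral_withDensity_eq_lintegral_mul _ (measurable_betaPDF _ _)]
    · refine lintegral_congr fun x => ?_
      rw [Pi.mul_apply]
      congr 1
      have hGx : Measurable (fun ω => G (fun v => x * (γ (min v u) ω / γ u ω))) :=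
        hGm.comp measurable_prodMk_left
      rw [← lintegral_const_mul _ hGx]
      refine lintegral_congr_ae ?_
      filter_upwards [hγ.zero, hγ.ae_strictMono] with ω h0 hs
      have hu0 := hs hu
      simp only [h0] at hu0
      simp only [div_self hu0.ne', mul_one]
    · have hm := hγ.measurable
      refine Measurable.lintegral_prod_right' (f := fun p : ℝ × Ω =>
        g (r, p.1 * (γ u p.2 / γ u p.2)) * G (fun v => p.1 * (γ (min v u) p.2 / γ u p.2))) ?_
      fun_prop
  have hjoint : Measurable (fun p : ℝ≥0 × ℝ => ENNReal.ofReal (bridgeDensity u p.1 p.2) *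
      (g (p.1, p.2) * ∫⁻ ω, G (fun v => p.2 * (γ (min v u) ω / γ u ω)) ∂P)) :=
    hd.mul (hg.mul (hh.comp measurable_snd))
  rw [setLIntegral_congr_fun measurableSet_Ioi h1, lintegral_lintegral_swap hjoint.aemeasurable]
  refine lintegral_congr fun x => ?_
  have hgx : Measurable (fun r => g (r, x) * ENNReal.ofReal (bridgeDensity u r x)) :=
    (hg.comp measurable_prodMk_right).mul (hd.comp measurable_prodMk_right)
  rw [← lintegral_const_mul _ hgx]
  refine lintegral_congr fun r => ?_
  ring

/-- The drift at time `u` is the conditional expectation of `(1 - ζ_u) / (τ - u)` on `{u < τ}` given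
the past. -/
theorem lintegral_bridgeDrift_mul (hγ : IsStandardGammaProcess γ P) {τ : Ω → ℝ≥0}
    (hτ : Measurable τ) (hind : IndepFun τ (fun (ω : Ω) (t : ℝ≥0) => γ t ω) P)
    {u : ℝ≥0} (hu : 0 < u) {G : (ℝ≥0 → ℝ) → ℝ≥0∞} (hG : Measurable G) :
    ∫⁻ ω, ENNReal.ofReal (bridgeDrift (P.map τ) u (randomGammaBridge γ τ u ω)) *
        G (fun v => randomGammaBridge γ τ (min v u) ω) ∂P =
      ∫⁻ r in Set.Ioi u, ∫⁻ ω, ENNReal.ofReal ((1 - gammaBridge γ r u ω) * ((r : ℝ) - u)⁻¹) *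
        G (fun v => gammaBridge γ r (min v u) ω) ∂P ∂P.map τ := by
  have := Measure.isProbabilityMeasure_map (μ := P) hτ.aemeasurable
  set ν := P.map τ with hν
  have hb : Measurable (fun x => ENNReal.ofReal (bridgeDrift ν u x)) :=
    ((measurable_bridgeDrift ν).comp (f := fun x => (u, x)) (by fun_prop)).ennreal_ofReal
  have h1 := lintegral_randomGammaBridge hγ hτ hind (F := fun p : ℝ≥0 × (ℝ≥0 → ℝ) =>
    ENNReal.ofReal (bridgeDrift ν u (p.2 u)) * G (fun v => p.2 (min v u)))
    (Measurable.mul (hb.comp (by fun_prop)) (hG.comp (by fun_prop)))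
  simp only at h1
  rw [h1, ← hν]
  have h2 : ∀ r, ∫⁻ ω, ENNReal.ofReal (bridgeDrift ν u (gammaBridge γ r u ω)) *
      G (fun v => gammaBridge γ r (min v u) ω) ∂P = (Set.Ioi u).indicator (fun r =>
        ∫⁻ ω, ENNReal.ofReal (bridgeDrift ν u (gammaBridge γ r u ω)) *
          G (fun v => gammaBridge γ r (min v u) ω) ∂P) r := by
    intro r
    by_cases hr : r ∈ Set.Ioi u
    · rw [Set.indicator_of_mem hr]
    · rw [Set.indicator_of_notMem hr]
      refine (lintegral_congr fun ω => ?_).trans lintegral_zero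
      rw [gammaBridge_of_le (not_lt.1 hr), bridgeDrift_of_notMem]
      · simp
      · rintro ⟨h, h'⟩
        rcases eq_or_ne (γ r ω) 0 with h0 | h0
        · simp [h0] at h
        · simp [div_self h0] at h'
  rw [lintegral_congr h2, lintegral_indicator measurableSet_Ioi,
    lintegral_gammaBridge_past_lintegral hγ ν hu
      (g := fun p => ENNReal.ofReal (bridgeDrift ν u p.2)) (hb.comp measurable_snd) hG,
    lintegral_gammaBridge_past_lintegral hγ ν hu
      (g := fun p => ENNReal.ofReal ((1 - p.2) * ((p.1 : ℝ) - u)⁻¹)) (by fun_prop) hG]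
  refine lintegral_congr fun x => ?_
  congr 1
  simp only
  have hd : Measurable (fun r : ℝ≥0 => ENNReal.ofReal (bridgeDensity u r x)) :=
    (measurable_bridgeDensity.comp (f := fun r : ℝ≥0 => (u, r, x)) (by fun_prop)).ennreal_ofReal
  rw [lintegral_const_mul _ hd, ofReal_bridgeDrift_mul_lintegral]

/-- For the bridge of length `r`, the mean increment over `(s, t]` on an event of the past of `s`.
-/
theorem lintegral_gammaBridge_sub (hγ : IsStandardGammaProcess γ P) {s t r : ℝ≥0} (hst : s ≤ t)
    (hr : 0 < r) {H : (ℝ≥0 → ℝ) → ℝ≥0∞} (hH : Measurable H) (hH1 : ∀ w, H w ≤ 1) :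
    ∫⁻ ω, ENNReal.ofReal (gammaBridge γ r t ω - gammaBridge γ r s ω) *
        H (fun v => gammaBridge γ r (min v s) ω) ∂P =
      ENNReal.ofReal (min (t : ℝ) r - s) * ENNReal.ofReal (((r : ℝ) - s)⁻¹) *
        ∫⁻ ω, ENNReal.ofReal (1 - gammaBridge γ r s ω) *
          H (fun v => gammaBridge γ r (min v s) ω) ∂P := by
  rcases le_or_gt r s with hrs | hrs
  · have h1 : min (t : ℝ) r - s ≤ 0 :=
      sub_nonpos.2 ((min_le_right _ _).trans (NNReal.coe_le_coe.2 hrs))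
    rw [ENNReal.ofReal_of_nonpos h1, zero_mul, zero_mul]
    refine (lintegral_congr fun ω => ?_).trans lintegral_zero
    rw [gammaBridge_of_le (hrs.trans hst), gammaBridge_of_le hrs]
    simp
  have hrs' : 0 < (r : ℝ) - s := sub_pos.2 (NNReal.coe_lt_coe.2 hrs)
  rcases le_or_gt r t with hrt | hrt
  · rw [min_eq_right (NNReal.coe_le_coe.2 hrt), ← ENNReal.ofReal_mul hrs'.le,
      mul_inv_cancel₀ hrs'.ne', ENNReal.ofReal_one, one_mul]
    refine lintegral_congr_ae ?_
    filter_upwards [hγ.zero, hγ.ae_strictMono] with ω h0 hs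
    have hr0 := hs hr
    simp only [h0] at hr0
    rw [gammaBridge_of_le hrt, div_self hr0.ne']
  · have hm := hγ.measurable
    have hbm : ∀ v, Measurable (gammaBridge γ r v) := fun v => (hm _).div (hm _)
    have hHm : Measurable (fun ω => H (fun v => gammaBridge γ r (min v s) ω)) :=
      hH.comp (measurable_pi_lambda _ fun v => hbm _)
    have hrt' : (t : ℝ) < r := NNReal.coe_lt_coe.2 hrt
    have hst' : (s : ℝ) ≤ t := NNReal.coe_le_coe.2 hst
    set K := ∫⁻ ω, ENNReal.ofReal (1 - gammaBridge γ r s ω) *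
          H (fun v => gammaBridge γ r (min v s) ω) ∂P with hK
    have hmono : ∀ᵐ ω ∂P, gammaBridge γ r s ω ≤ gammaBridge γ r t ω ∧
        gammaBridge γ r t ω ≤ 1 ∧ 0 ≤ gammaBridge γ r s ω := by
      filter_upwards [hγ.zero, hγ.ae_strictMono] with ω h0 hs
      have hr0 := hs hr
      simp only [h0] at hr0
      refine ⟨div_le_div_of_nonneg_right (hs.monotone (min_le_min_right _ hst)) hr0.le,
        (div_le_one hr0).2 (hs.monotone (min_le_right _ _)),
        gammaBridge_nonneg h0 hs _ _⟩
    have hKfin : K ≠ ∞ := by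
      refine ((lintegral_mono_ae (g := fun _ => 1) ?_).trans_lt (by simp)).ne
      filter_upwards [hmono] with ω hω
      refine mul_le_one' (ENNReal.ofReal_le_one.2 ?_) (hH1 _)
      linarith [hω.2.2]
    -- The equation is obtained by cancelling the mean of `1 - ζ^r_t`, which is finite as `H ≤ 1`.
    have hsum : ∫⁻ ω, ENNReal.ofReal (gammaBridge γ r t ω - gammaBridge γ r s ω) *
        H (fun v => gammaBridge γ r (min v s) ω) ∂P +
        ENNReal.ofReal (((r : ℝ) - t) / (r - s)) * K = K := by
      rw [hK, ← hγ.lintegral_one_sub_gammaBridge hst hrt hH, ← lintegral_add_right]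
      · refine lintegral_congr_ae ?_
        filter_upwards [hmono] with ω hω
        rw [← add_mul, ← ENNReal.ofReal_add (sub_nonneg.2 hω.1) (sub_nonneg.2 hω.2.1)]
        congr 2
        ring
      · have := hbm t
        fun_prop
    have hsplit : ENNReal.ofReal (t - s) * ENNReal.ofReal (((r : ℝ) - s)⁻¹) * K +
        ENNReal.ofReal (((r : ℝ) - t) / (r - s)) * K = K := by
      rw [← add_mul, ← ENNReal.ofReal_mul (sub_nonneg.2 hst'),
        ← ENNReal.ofReal_add (mul_nonneg (sub_nonneg.2 hst') (inv_nonneg.2 hrs'.le))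
          (div_nonneg (sub_pos.2 hrt').le hrs'.le)]
      rw [show (t - s) * ((r : ℝ) - s)⁻¹ + (r - t) / (r - s) = 1 by field_simp; ring]
      simp
    rw [min_eq_left hrt'.le]
    exact (ENNReal.add_left_inj (ENNReal.mul_ne_top ENNReal.ofReal_ne_top hKfin)).1
      (hsum.trans hsplit.symm)

theorem lintegral_lintegral_mul_swap {F : Ω → ℝ → ℝ≥0∞} (hF : Measurable (Function.uncurry F))
    {h : Ω → ℝ≥0∞} (hh : Measurable h) (I : Set ℝ) :
    ∫⁻ ω, (∫⁻ u in I, F ω u) * h ω ∂P = ∫⁻ u in I, ∫⁻ ω, F ω u * h ω ∂P := by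
  have hJ : Measurable (Function.uncurry fun ω u => F ω u * h ω) := hF.mul (hh.comp measurable_fst)
  rw [← lintegral_lintegral_swap hJ.aemeasurable]
  refine lintegral_congr fun ω => ?_
  rw [lintegral_mul_const _ hF.of_uncurry_left]

theorem lintegral_lintegral_bridgeDrift_mul_swap (hγ : IsStandardGammaProcess γ P) {τ : Ω → ℝ≥0}
    (hτ : Measurable τ) (ν : Measure ℝ≥0) [IsProbabilityMeasure ν] (I : Set ℝ) (s : ℝ≥0)
    {H : (ℝ≥0 → ℝ) → ℝ≥0∞} (hH : Measurable H) :
    ∫⁻ ω, (∫⁻ u in I, ENNReal.ofReal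
        (bridgeDrift ν u.toNNReal (randomGammaBridge γ τ u.toNNReal ω))) *
        H (fun v => randomGammaBridge γ τ (min v s) ω) ∂P =
      ∫⁻ u in I, ∫⁻ ω, ENNReal.ofReal
        (bridgeDrift ν u.toNNReal (randomGammaBridge γ τ u.toNNReal ω)) *
        H (fun v => randomGammaBridge γ τ (min v s) ω) ∂P := by
  obtain ⟨Z, hZm, hZ⟩ := exists_measurable_version hγ hτ
  have hHm : Measurable (fun ω => H (fun v => Z (min v s) ω)) :=
    hH.comp (measurable_pi_lambda _ fun v => hZm.comp measurable_prodMk_left)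
  have hZ' : Measurable (fun p : Ω × ℝ => Z p.2.toNNReal p.1) :=
    hZm.comp (f := fun p : Ω × ℝ => (p.2.toNNReal, p.1)) (by fun_prop)
  have hF : Measurable (Function.uncurry fun ω (u : ℝ) =>
      ENNReal.ofReal (bridgeDrift ν u.toNNReal (Z u.toNNReal ω))) :=
    (measurable_bridgeDrift ν).ennreal_ofReal.comp (f := fun p : Ω × ℝ =>
      (p.2.toNNReal, Z p.2.toNNReal p.1)) (by fun_prop)
  refine ((lintegral_congr_ae ?_).trans (lintegral_lintegral_mul_swap hF hHm I)).trans
    (lintegral_congr fun u => lintegral_congr_ae ?_)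
  · filter_upwards [hZ] with ω hω
    simp only [hω]
  · filter_upwards [hZ] with ω hω
    simp only [hω]

/-- The increments of the bridge and of its compensator over `(s, t]` have the same mean on every
event of the past of `s`. -/
theorem lintegral_lintegral_bridgeDrift_mul (hγ : IsStandardGammaProcess γ P) {τ : Ω → ℝ≥0}
    (hτ : Measurable τ) (hτ_pos : ∀ ω, 0 < τ ω)
    (hind : IndepFun τ (fun (ω : Ω) (t : ℝ≥0) => γ t ω) P)
    {s t : ℝ≥0} (hst : s ≤ t) {H : (ℝ≥0 → ℝ) → ℝ≥0∞} (hH : Measurable H) (hH1 : ∀ w, H w ≤ 1) :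
    ∫⁻ ω, (∫⁻ u in Set.Ioc (s : ℝ) t, ENNReal.ofReal
        (bridgeDrift (P.map τ) u.toNNReal (randomGammaBridge γ τ u.toNNReal ω))) *
        H (fun v => randomGammaBridge γ τ (min v s) ω) ∂P =
      ∫⁻ ω, ENNReal.ofReal (randomGammaBridge γ τ t ω - randomGammaBridge γ τ s ω) *
        H (fun v => randomGammaBridge γ τ (min v s) ω) ∂P := by
  have := Measure.isProbabilityMeasure_map (μ := P) hτ.aemeasurable
  set ν := P.map τ with hν
  set K : ℝ≥0 → ℝ≥0∞ := fun r => ∫⁻ ω, ENNReal.ofReal (1 - gammaBridge γ r s ω) *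
    H (fun v => gammaBridge γ r (min v s) ω) ∂P with hK
  have hKm : Measurable K :=
    measurable_lintegral_gammaBridge hγ (F := fun p : ℝ≥0 × (ℝ≥0 → ℝ) =>
      ENNReal.ofReal (1 - p.2 s) * H (fun v => p.2 (min v s)))
      (Measurable.mul (by fun_prop) (hH.comp (by fun_prop)))
  have hinner : ∀ u ∈ Set.Ioc (s : ℝ) t, ∫⁻ ω, ENNReal.ofReal
        (bridgeDrift ν u.toNNReal (randomGammaBridge γ τ u.toNNReal ω)) *
        H (fun v => randomGammaBridge γ τ (min v s) ω) ∂P =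
      ∫⁻ r, (if u < r then 1 else 0) * (ENNReal.ofReal (((r : ℝ) - s)⁻¹) * K r) ∂ν := by
    intro u hu
    have hu0 : 0 < u := s.2.trans_lt hu.1
    have hsu : s ≤ u.toNNReal := NNReal.le_toNNReal_of_coe_le hu.1.le
    have h := lintegral_bridgeDrift_mul hγ hτ hind (Real.toNNReal_pos.2 hu0)
      (G := fun w => H (fun v => w (min v s))) (hH.comp (by fun_prop))
    have hmin : ∀ v, min (min v s) u.toNNReal = min v s := fun v =>
      min_eq_left ((min_le_right v s).trans hsu)
    simp only [hmin, ← hν] at h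
    rw [h, ← lintegral_indicator measurableSet_Ioi]
    refine lintegral_congr fun r => ?_
    by_cases hr : u < r
    · have hr' : u.toNNReal < r := (Real.toNNReal_lt_iff_lt_coe hu0.le).2 hr
      have hru : 0 < (r : ℝ) - u := sub_pos.2 hr
      have hrs : 0 < (r : ℝ) - s := by linarith [hu.1]
      rw [if_pos hr, one_mul, Set.indicator_of_mem (Set.mem_Ioi.2 hr'),
        Real.coe_toNNReal _ hu0.le]
      have hm := hγ.measurable
      have hbm : ∀ v, Measurable (gammaBridge γ r v) := fun v => (hm _).div (hm _)
      have hHr : Measurable (fun ω => H (fun v => gammaBridge γ r (min v s) ω)) :=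
        hH.comp (measurable_pi_lambda _ fun v => hbm _)
      have hbu := hbm u.toNNReal
      calc _ = ENNReal.ofReal ((r : ℝ) - u)⁻¹ * ∫⁻ ω,
            ENNReal.ofReal (1 - gammaBridge γ r u.toNNReal ω) *
              H (fun v => gammaBridge γ r (min v s) ω) ∂P := by
            rw [← lintegral_const_mul _ (by fun_prop)]
            refine lintegral_congr fun ω => ?_
            rw [mul_comm (1 - _), ENNReal.ofReal_mul (inv_nonneg.2 hru.le), mul_assoc]
        _ = _ := by
            rw [hγ.lintegral_one_sub_gammaBridge hsu hr' hH, Real.coe_toNNReal _ hu0.le,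
              ← mul_assoc, ← ENNReal.ofReal_mul (inv_nonneg.2 hru.le)]
            congr 2
            field_simp
    · have hr' : r ∉ Set.Ioi u.toNNReal := fun h =>
        hr ((Real.toNNReal_lt_iff_lt_coe hu0.le).1 h)
      rw [if_neg hr, zero_mul, Set.indicator_of_notMem hr']
  rw [lintegral_lintegral_bridgeDrift_mul_swap hγ hτ ν _ s hH,
    setLIntegral_congr_fun measurableSet_Ioc hinner]
  have hlt : Measurable (fun p : ℝ × ℝ≥0 => if p.1 < (p.2 : ℝ) then (1 : ℝ≥0∞) else 0) :=
    Measurable.ite (measurableSet_lt (by fun_prop) (by fun_prop)) measurable_const measurable_const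
  rw [lintegral_lintegral_swap (Measurable.aemeasurable
      (f := fun p : ℝ × ℝ≥0 => (if p.1 < (p.2 : ℝ) then (1 : ℝ≥0∞) else 0) *
        (ENNReal.ofReal (((p.2 : ℝ) - s)⁻¹) * K p.2)) (by fun_prop)),
    lintegral_randomGammaBridge hγ hτ hind (F := fun p : ℝ≥0 × (ℝ≥0 → ℝ) =>
      ENNReal.ofReal (p.2 t - p.2 s) * H (fun v => p.2 (min v s)))
      (Measurable.mul (by fun_prop) (hH.comp (by fun_prop)))]
  have hνpos : ∀ᵐ r ∂ν, 0 < r := by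
    rw [hν, ae_map_iff hτ.aemeasurable measurableSet_Ioi]
    exact ae_of_all _ hτ_pos
  refine lintegral_congr_ae ?_
  filter_upwards [hνpos] with r hr
  have hltr : Measurable (fun u : ℝ => if u < (r : ℝ) then (1 : ℝ≥0∞) else 0) :=
    hlt.comp measurable_prodMk_right
  rw [lintegral_mul_const _ hltr,
    lintegral_gammaBridge_sub hγ hst hr hH hH1, mul_assoc]
  congr 1
  have hset : ∀ u : ℝ, (if u < (r : ℝ) then (1 : ℝ≥0∞) else 0) =
      (Set.Iio (r : ℝ)).indicator 1 u := fun u => rfl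
  simp only [hset]
  rw [lintegral_indicator_one measurableSet_Iio, Measure.restrict_apply measurableSet_Iio]
  have hae : (Set.Iio (r : ℝ) ∩ Set.Ioc (s : ℝ) t : Set ℝ) =ᵐ[volume]
      (Set.Ioc (s : ℝ) (min t r) : Set ℝ) := by
    have : Set.Ioc (s : ℝ) (min t r) = Set.Iic (r : ℝ) ∩ Set.Ioc (s : ℝ) t := by
      ext u
      simp only [Set.mem_Ioc, Set.mem_inter_iff, Set.mem_Iic, le_min_iff]
      tauto
    rw [this]
    exact Iio_ae_eq_Iic.inter (ae_eq_refl _)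
  rw [measure_congr hae, Real.volume_Ioc]

end RandomLength

/-! ### Predictability of continuous adapted processes -/

/-- The last point of the grid `{k / (n + 1)}` that lies strictly to the left of `x > 0`; it is `0`
for `x = 0`. -/
noncomputable def leftGrid (n : ℕ) (x : ℝ≥0) : ℝ≥0 :=
  ((⌈x * (n + 1)⌉₊ - 1 : ℕ) : ℝ≥0) / ((n : ℝ≥0) + 1)

theorem leftGrid_zero (n : ℕ) : leftGrid n 0 = 0 := by simp [leftGrid]

theorem leftGrid_eq {n k : ℕ} {x : ℝ≥0} (h1 : (k : ℝ≥0) / (n + 1) < x)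
    (h2 : x ≤ ((k : ℝ≥0) + 1) / (n + 1)) : leftGrid n x = (k : ℝ≥0) / (n + 1) := by
  have hn : (0 : ℝ≥0) < n + 1 := by positivity
  rw [div_lt_iff₀ hn] at h1
  rw [le_div_iff₀ hn] at h2
  have : ⌈x * (n + 1)⌉₊ = k + 1 := by
    rw [Nat.ceil_eq_iff (by omega)]
    refine ⟨by simpa using h1, by simpa using h2⟩
  rw [leftGrid, this, Nat.add_sub_cancel]

theorem exists_leftGrid_interval (n : ℕ) {x : ℝ≥0} (hx : 0 < x) :
    ∃ k : ℕ, (k : ℝ≥0) / (n + 1) < x ∧ x ≤ ((k : ℝ≥0) + 1) / (n + 1) := by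
  have hn : (0 : ℝ≥0) < n + 1 := by positivity
  obtain ⟨k, hk⟩ := Nat.exists_eq_succ_of_ne_zero (Nat.ceil_pos.2 (mul_pos hx hn)).ne'
  rw [Nat.ceil_eq_iff (by omega)] at hk
  refine ⟨k, ?_, ?_⟩
  · rw [div_lt_iff₀ hn]
    simpa using hk.1
  · rw [le_div_iff₀ hn]
    simpa using hk.2

theorem tendsto_leftGrid (x : ℝ≥0) : Tendsto (fun n => leftGrid n x) atTop (𝓝 x) := by
  rcases eq_or_lt_of_le (zero_le (a := x)) with rfl | hx
  · simp only [leftGrid_zero]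
    exact tendsto_const_nhds
  rw [← NNReal.tendsto_coe]
  have h1 : Tendsto (fun n : ℕ => (x : ℝ) - 1 / ((n : ℝ) + 1)) atTop (𝓝 (x - 0)) :=
    tendsto_const_nhds.sub tendsto_one_div_add_atTop_nhds_zero_nat
  rw [sub_zero] at h1
  refine tendsto_of_tendsto_of_tendsto_of_le_of_le h1 tendsto_const_nhds (fun n => ?_) fun n => ?_
  all_goals
    obtain ⟨k, hk1, hk2⟩ := exists_leftGrid_interval n hx
    simp only [leftGrid_eq hk1 hk2]
  · have h2 : (x : ℝ) ≤ ((k : ℝ) + 1) / (n + 1) := by exact_mod_cast hk2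
    push_cast
    rw [add_div] at h2
    linarith
  · exact NNReal.coe_le_coe.2 hk1.le

theorem MeasureTheory.StronglyAdapted.isStronglyPredictable_of_continuous {Ω : Type*}
    {mΩ : MeasurableSpace Ω} {ℱ : Filtration ℝ≥0 mΩ} {A : ℝ≥0 → Ω → ℝ} (hA : StronglyAdapted ℱ A)
    (hc : ∀ ω, Continuous (fun t => A t ω)) : IsStronglyPredictable ℱ A := by
  have hstep : ∀ n : ℕ, Measurable[ℱ.predictable]
      (fun p : ℝ≥0 × Ω => A (leftGrid n p.1) p.2) := by
    intro n S hS
    have hpre : ∀ t, MeasurableSet[ℱ t] (A t ⁻¹' S) := fun t => (hA t).measurable hS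
    have heq : (fun p : ℝ≥0 × Ω => A (leftGrid n p.1) p.2) ⁻¹' S =
        ({⊥} ×ˢ (A ⊥ ⁻¹' S)) ∪ ⋃ k : ℕ, Set.Ioc ((k : ℝ≥0) / (n + 1)) (((k : ℝ≥0) + 1) / (n + 1)) ×ˢ
          (A ((k : ℝ≥0) / (n + 1)) ⁻¹' S) := by
      ext ⟨x, ω⟩
      simp only [Set.mem_preimage, Set.mem_union, Set.mem_prod, Set.mem_singleton_iff,
        Set.mem_iUnion, Set.mem_Ioc, bot_eq_zero']
      constructor
      · intro h
        rcases eq_or_lt_of_le (zero_le (a := x)) with rfl | hx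
        · rw [leftGrid_zero] at h
          exact Or.inl ⟨rfl, h⟩
        · obtain ⟨k, hk1, hk2⟩ := exists_leftGrid_interval n hx
          rw [leftGrid_eq hk1 hk2] at h
          exact Or.inr ⟨k, ⟨hk1, hk2⟩, h⟩
      · rintro (⟨rfl, h⟩ | ⟨k, ⟨hk1, hk2⟩, h⟩)
        · rwa [leftGrid_zero]
        · rwa [leftGrid_eq hk1 hk2]
    rw [heq]
    exact @MeasurableSet.union _ ℱ.predictable _ _
      (measurableSet_predictable_singleton_bot_prod (hpre ⊥))
      (@MeasurableSet.iUnion _ _ ℱ.predictable _ _ fun k =>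
        measurableSet_predictable_Ioc_prod _ _ (hpre _))
  refine Measurable.stronglyMeasurable ?_
  refine @measurable_of_tendsto_metrizable _ _ ℱ.predictable _ _ _ _
    (fun n (p : ℝ≥0 × Ω) => A (leftGrid n p.1) p.2) _ hstep (tendsto_pi_nhds.2 fun p => ?_)
  exact ((hc p.2).tendsto p.1).comp (tendsto_leftGrid p.1)

/-! ### Time integrals of adapted right-continuous processes -/

theorem ContinuousWithinAt.comp_min_const {f : ℝ≥0 → ℝ}
    (hf : ∀ t, ContinuousWithinAt f (Set.Ici t) t) (T t : ℝ≥0) :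
    ContinuousWithinAt (fun s => f (min s T)) (Set.Ici t) t :=
  ContinuousWithinAt.comp (f := fun s => min s T) (t := Set.Ici (min t T)) (hf (min t T))
    (continuous_id.min continuous_const).continuousWithinAt fun _ hs => min_le_min_right T hs

theorem measurable_intervalIntegral_of_rightContinuous {α : Type*} [MeasurableSpace α]
    {Y : ℝ≥0 → α → ℝ} {t : ℝ≥0} (hY : ∀ s ≤ t, Measurable (Y s))
    (hc : ∀ ω s, ContinuousWithinAt (fun s => Y s ω) (Set.Ici s) s) {b : ℝ≥0 × ℝ → ℝ}
    (hb : Measurable b) :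
    Measurable (fun ω => ∫ s in (0 : ℝ)..t, b (s.toNNReal, Y s.toNNReal ω)) := by
  have h1 : Measurable (fun p : ℝ≥0 × α => Y (min p.1 t) p.2) :=
    measurable_uncurry_of_rightContinuous (Y := fun s => Y (min s t))
      (fun s => hY _ (min_le_right _ _)) fun ω s => ContinuousWithinAt.comp_min_const (hc ω) t s
  have h2 : Measurable (fun p : α × ℝ => b (p.2.toNNReal, Y (min p.2.toNNReal t) p.1)) :=
    hb.comp (Measurable.prodMk (by fun_prop)
      (h1.comp (f := fun p : α × ℝ => (p.2.toNNReal, p.1)) (by fun_prop)))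
  have h3 := (StronglyMeasurable.integral_prod_right'
    (ν := volume.restrict (Set.Ioc (0 : ℝ) t)) h2.stronglyMeasurable).measurable
  convert h3 using 2 with ω
  rw [intervalIntegral.integral_of_le NNReal.zero_le_coe]
  refine setIntegral_congr_fun measurableSet_Ioc fun s hs => ?_
  have : s.toNNReal ≤ t := Real.toNNReal_le_iff_le_coe.2 hs.2
  simp only [min_eq_left this]

/-! ### The completed natural filtration -/

section CompletedFiltration

variable {Ω : Type*} {mΩ : MeasurableSpace Ω} {P : Measure Ω} [P.IsComplete] {Y : ℝ≥0 → Ω → ℝ}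
  {hY : ∀ t, Measurable (Y t)}

theorem measurable_completedNaturalFiltration {s t : ℝ≥0} (hst : s ≤ t) :
    Measurable[completedNaturalFiltration P Y hY t] (Y s) := by
  rw [measurable_iff_comap_le]
  exact le_sup_of_le_left (le_iSup₂_of_le s hst le_rfl)

theorem measurableSet_completedNaturalFiltration_of_ae_eq {t : ℝ≥0} {S T : Set Ω}
    (hS : MeasurableSet[completedNaturalFiltration P Y hY t] S) (h : S =ᵐ[P] T) :
    MeasurableSet[completedNaturalFiltration P Y hY t] T := by
  have hnull : ∀ N : Set Ω, P N = 0 → MeasurableSet[completedNaturalFiltration P Y hY t] N :=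
    fun N hN => (le_sup_right : _ ≤ completedNaturalFiltration P Y hY t) _
      (MeasurableSpace.measurableSet_generateFrom hN)
  obtain ⟨h1, h2⟩ := ae_eq_set.1 h
  have hT : T = (S \ (S \ T)) ∪ (T \ S) := by
    ext ω
    simp only [Set.mem_union, Set.mem_sdiff]
    tauto
  rw [hT]
  exact (hS.diff (hnull _ h1)).union (hnull _ h2)

theorem measurable_completedNaturalFiltration_of_ae_eq {t : ℝ≥0} {f g : Ω → ℝ}
    (hf : Measurable[completedNaturalFiltration P Y hY t] f) (h : f =ᵐ[P] g) :
    Measurable[completedNaturalFiltration P Y hY t] g := fun B hB => by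
  refine measurableSet_completedNaturalFiltration_of_ae_eq (hf hB) ?_
  filter_upwards [h] with ω hω
  change (f ω ∈ B) = (g ω ∈ B)
  rw [hω]

/-- Up to a null set, an event of the completed past is an event of the path stopped at `t`. -/
theorem exists_preimage_ae_eq_of_completedNaturalFiltration {t : ℝ≥0} {S : Set Ω}
    (hS : MeasurableSet[completedNaturalFiltration P Y hY t] S) :
    ∃ B : Set (ℝ≥0 → ℝ), MeasurableSet B ∧ S =ᵐ[P] (fun ω v => Y (min v t) ω) ⁻¹' B := by
  have hle : (completedNaturalFiltration P Y hY t : MeasurableSpace Ω) ≤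
      eventuallyMeasurableSpace
        (MeasurableSpace.comap (fun ω v => Y (min v t) ω) MeasurableSpace.pi) (ae P) := by
    refine sup_le (iSup₂_le fun s hs => ?_) (MeasurableSpace.generateFrom_le fun N hN => ?_)
    · refine le_trans ?_ (@le_eventuallyMeasurableSpace _
        (MeasurableSpace.comap (fun ω v => Y (min v t) ω) MeasurableSpace.pi) _ _)
      rintro - ⟨B, hB, rfl⟩
      refine ⟨(fun w => w s) ⁻¹' B, measurable_pi_apply s hB, ?_⟩
      simp only [← Set.preimage_comp, Function.comp_def, min_eq_left hs]
    · exact ⟨∅, @MeasurableSet.empty _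
        (MeasurableSpace.comap (fun ω v => Y (min v t) ω) MeasurableSpace.pi), ae_eq_empty.2 hN⟩
  obtain ⟨-, ⟨B, hB, rfl⟩, h⟩ := hle S hS
  exact ⟨B, hB, h⟩

end CompletedFiltration

/-! ### Paths of the bridge -/

/-- The properties shared by almost all paths of a bridge of length `T`: a nondecreasing càdlàg path
from `0`, which is below `1` before `T` and equal to `1` from `T` on. -/
structure IsBridgePath (T : ℝ≥0) (z : ℝ≥0 → ℝ) : Prop where
  cadlag : IsCadlag z
  mono : Monotone z
  zero : z 0 = 0
  lt_one : ∀ t < T, z t < 1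
  eq_one : ∀ t, T ≤ t → z t = 1

theorem IsBridgePath.le_one {T : ℝ≥0} {z : ℝ≥0 → ℝ} (h : IsBridgePath T z) (t : ℝ≥0) : z t ≤ 1 :=
  (lt_or_ge t T).elim (fun ht => (h.lt_one t ht).le) fun ht => (h.eq_one t ht).le

theorem IsBridgePath.nonneg {T : ℝ≥0} {z : ℝ≥0 → ℝ} (h : IsBridgePath T z) (t : ℝ≥0) : 0 ≤ z t :=
  h.zero ▸ h.mono zero_le

theorem IsCadlag.comp_min_const {f : ℝ≥0 → ℝ} (hf : IsCadlag f) (T : ℝ≥0) :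
    IsCadlag (fun t => f (min t T)) := by
  refine fun t => ⟨ContinuousWithinAt.comp_min_const (fun t => (hf t).1) T t, ?_⟩
  rcases le_or_gt t T with ht | ht
  · obtain ⟨l, hl⟩ := (hf t).2
    refine ⟨l, hl.congr' ?_⟩
    filter_upwards [self_mem_nhdsWithin] with s hs
    rw [min_eq_left ((le_of_lt hs).trans ht)]
  · refine ⟨f T, tendsto_const_nhds.congr' ?_⟩
    filter_upwards [mem_nhdsWithin_of_mem_nhds (Ioi_mem_nhds ht)] with s hs
    rw [min_eq_right (le_of_lt hs)]

theorem IsCadlag.div_const {f : ℝ≥0 → ℝ} (hf : IsCadlag f) (c : ℝ) :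
    IsCadlag (fun t => f t / c) := fun t =>
  ⟨(hf t).1.div_const c, let ⟨l, hl⟩ := (hf t).2; ⟨l / c, hl.div_const c⟩⟩

theorem IsCadlag.sub {f g : ℝ≥0 → ℝ} (hf : IsCadlag f) (hg : IsCadlag g) :
    IsCadlag (fun t => f t - g t) := fun t =>
  ⟨(hf t).1.sub (hg t).1, let ⟨l, hl⟩ := (hf t).2; let ⟨k, hk⟩ := (hg t).2; ⟨l - k, hl.sub hk⟩⟩

theorem Continuous.isCadlag {f : ℝ≥0 → ℝ} (hf : Continuous f) : IsCadlag f := fun t =>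
  ⟨hf.continuousWithinAt, f t, (hf.tendsto t).mono_left nhdsWithin_le_nhds⟩

section Bridge

variable {Ω : Type*} [mΩ : MeasurableSpace Ω] {P : Measure Ω}
  {γ : ℝ≥0 → Ω → ℝ} {τ : Ω → ℝ≥0}

/-! ### The compensator -/

variable (P γ τ) in
/-- The event that the path of the bridge is regular and its drift integrable. It has probability
one by `ae_mem_regularSet`. -/
def regularSet : Set Ω :=
  {ω | IsBridgePath (τ ω) (fun t => randomGammaBridge γ τ t ω) ∧ ∀ t : ℝ≥0,
    IntervalIntegrable (fun s : ℝ =>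
      bridgeDrift (P.map τ) s.toNNReal (randomGammaBridge γ τ s.toNNReal ω)) volume 0 t}

variable (P γ τ) in
/-- The bridge, set to `0` outside the regular event. All of its paths are right-continuous, and its
drift is integrable on all of them. -/
noncomputable def regularBridge (t : ℝ≥0) (ω : Ω) : ℝ :=
  (regularSet P γ τ).indicator (randomGammaBridge γ τ t) ω

variable (P γ τ) in
/-- The integrated drift of the bridge. It is built from the regularized bridge, so that all paths
are continuous. -/
noncomputable def bridgeCompensator (t : ℝ≥0) (ω : Ω) : ℝ :=
  ∫ s in (0 : ℝ)..t, bridgeDrift (P.map τ) s.toNNReal (regularBridge P γ τ s.toNNReal ω)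

theorem regularBridge_of_mem {ω : Ω} (hω : ω ∈ regularSet P γ τ) (t : ℝ≥0) :
    regularBridge P γ τ t ω = randomGammaBridge γ τ t ω :=
  Set.indicator_of_mem hω _

theorem regularBridge_of_notMem {ω : Ω} (hω : ω ∉ regularSet P γ τ) (t : ℝ≥0) :
    regularBridge P γ τ t ω = 0 :=
  Set.indicator_of_notMem hω _

theorem bridgeCompensator_of_mem {ω : Ω} (hω : ω ∈ regularSet P γ τ) (t : ℝ≥0) :
    bridgeCompensator P γ τ t ω = ∫ s in (0 : ℝ)..t,
      bridgeDrift (P.map τ) s.toNNReal (randomGammaBridge γ τ s.toNNReal ω) := by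
  simp only [bridgeCompensator, regularBridge_of_mem hω]

theorem regularBridge_zero (ω : Ω) : regularBridge P γ τ 0 ω = 0 := by
  by_cases hω : ω ∈ regularSet P γ τ
  · rw [regularBridge_of_mem hω]
    exact hω.1.zero
  · rw [regularBridge_of_notMem hω]

theorem bridgeCompensator_zero (ω : Ω) : bridgeCompensator P γ τ 0 ω = 0 := by
  simp [bridgeCompensator]

theorem measurable_randomGammaBridge_bridgeFiltration [P.IsComplete]
    (hγ : IsStandardGammaProcess γ P)
    (hτ : Measurable τ) {s t : ℝ≥0} (hst : s ≤ t) :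
    Measurable[bridgeFiltration hγ hτ t] (randomGammaBridge γ τ s) :=
  measurable_completedNaturalFiltration hst

theorem continuousWithinAt_regularBridge (ω : Ω) (t : ℝ≥0) :
    ContinuousWithinAt (fun t => regularBridge P γ τ t ω) (Set.Ici t) t := by
  by_cases hω : ω ∈ regularSet P γ τ
  · simp only [regularBridge_of_mem hω]
    exact (hω.1.cadlag t).1
  · simp only [regularBridge_of_notMem hω]
    exact continuousWithinAt_const

theorem intervalIntegrable_regularBridge (ω : Ω) (a b : ℝ) :
    IntervalIntegrable (fun s : ℝ =>
      bridgeDrift (P.map τ) s.toNNReal (regularBridge P γ τ s.toNNReal ω)) volume a b := by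
  have hz : ∀ c : ℝ, IntervalIntegrable (fun s : ℝ =>
      bridgeDrift (P.map τ) s.toNNReal (regularBridge P γ τ s.toNNReal ω)) volume 0 c := by
    intro c
    have hzero : IntervalIntegrable (fun _ : ℝ => (0 : ℝ)) volume 0 c := by simp
    by_cases hω : ω ∈ regularSet P γ τ
    · rcases le_or_gt 0 c with hc | hc
      · lift c to ℝ≥0 using hc
        simp only [regularBridge_of_mem hω]
        exact hω.2 c
      · refine hzero.congr fun s hs => ?_
        rw [Set.uIoc_of_ge hc.le] at hs
        rw [Real.toNNReal_of_nonpos hs.2, regularBridge_zero, bridgeDrift_of_notMem]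
        simp
    · refine hzero.congr fun s _ => ?_
      rw [regularBridge_of_notMem hω, bridgeDrift_of_notMem]
      simp
  exact (hz a).symm.trans (hz b)

theorem continuous_bridgeCompensator (ω : Ω) :
    Continuous (fun t => bridgeCompensator P γ τ t ω) :=
  (intervalIntegral.continuous_primitive (intervalIntegrable_regularBridge ω) 0).comp
    NNReal.continuous_coe

theorem bridgeCompensator_sub (s t : ℝ≥0) (ω : Ω) :
    bridgeCompensator P γ τ t ω - bridgeCompensator P γ τ s ω = ∫ u in (s : ℝ)..t,
      bridgeDrift (P.map τ) u.toNNReal (regularBridge P γ τ u.toNNReal ω) :=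
  intervalIntegral.integral_interval_sub_left (intervalIntegrable_regularBridge ω _ _)
    (intervalIntegrable_regularBridge ω _ _)

theorem monotone_bridgeCompensator (ω : Ω) :
    Monotone (fun t => bridgeCompensator P γ τ t ω) := fun s t hst => by
  rw [← sub_nonneg, bridgeCompensator_sub]
  exact intervalIntegral.integral_nonneg (NNReal.coe_le_coe.2 hst) fun _ _ =>
    bridgeDrift_nonneg _ _ _

theorem ofReal_bridgeCompensator_sub {s t : ℝ≥0} (hst : s ≤ t) {ω : Ω}
    (hω : ω ∈ regularSet P γ τ) :
    ENNReal.ofReal (bridgeCompensator P γ τ t ω - bridgeCompensator P γ τ s ω) =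
      ∫⁻ u in Set.Ioc (s : ℝ) t, ENNReal.ofReal
        (bridgeDrift (P.map τ) u.toNNReal (randomGammaBridge γ τ u.toNNReal ω)) := by
  have hst' := NNReal.coe_le_coe.2 hst
  rw [bridgeCompensator_sub, intervalIntegral.integral_of_le hst',
    ofReal_integral_eq_lintegral_ofReal]
  · simp only [regularBridge_of_mem hω]
  · exact (intervalIntegrable_iff_integrableOn_Ioc_of_le hst').1
      (intervalIntegrable_regularBridge ω _ _)
  · exact ae_of_all _ fun _ => bridgeDrift_nonneg _ _ _

/-- From time `τ` on the bridge stays at `1`, where the drift vanishes. -/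
theorem bridgeCompensator_min {ω : Ω} (hω : ω ∈ regularSet P γ τ) (t : ℝ≥0) :
    bridgeCompensator P γ τ (min t (τ ω)) ω = bridgeCompensator P γ τ t ω := by
  rcases le_or_gt t (τ ω) with ht | ht
  · rw [min_eq_left ht]
  · rw [min_eq_right ht.le]
    symm
    rw [← sub_eq_zero, bridgeCompensator_sub]
    refine intervalIntegral.integral_zero_ae (ae_of_all _ fun u hu => ?_)
    rw [Set.uIoc_of_le (NNReal.coe_le_coe.2 ht.le)] at hu
    have h1 := hω.1.eq_one u.toNNReal (NNReal.le_toNNReal_of_coe_le hu.1.le)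
    rw [regularBridge_of_mem hω, h1, bridgeDrift_of_notMem]
    simp

/-! ### Integrability of the drift -/

variable [IsProbabilityMeasure P]

theorem ae_isBridgePath (hγ : IsStandardGammaProcess γ P) (hτ_pos : ∀ ω, 0 < τ ω) :
    ∀ᵐ ω ∂P, IsBridgePath (τ ω) (fun t => randomGammaBridge γ τ t ω) := by
  filter_upwards [hγ.zero, hγ.ae_strictMono, hγ.cadlag] with ω h0 hs hc
  have hpos : 0 < γ (τ ω) ω := by
    have := hs (hτ_pos ω)
    simpa only [h0] using this
  refine ⟨(hc.comp_min_const (τ ω)).div_const _, fun s t hst =>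
    div_le_div_of_nonneg_right (hs.monotone (min_le_min_right _ hst)) hpos.le, ?_,
    fun t ht => ?_, fun t ht => ?_⟩
  · simp [randomGammaBridge, gammaBridge, h0]
  · rw [randomGammaBridge, gammaBridge, min_eq_left ht.le, div_lt_one hpos]
    exact hs ht
  · rw [randomGammaBridge, gammaBridge_of_le ht, div_self hpos.ne']

theorem measurable_bridgeDrift_comp (ν : Measure ℝ≥0) [IsProbabilityMeasure ν] {z : ℝ≥0 → ℝ}
    (hz : Monotone z) : Measurable (fun s : ℝ => bridgeDrift ν s.toNNReal (z s.toNNReal)) := by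
  have := hz.measurable
  exact (measurable_bridgeDrift ν).comp
    (f := fun s : ℝ => (s.toNNReal, z s.toNNReal)) (by fun_prop)

theorem lintegral_lintegral_bridgeDrift_le_one (hγ : IsStandardGammaProcess γ P)
    (hτ : Measurable τ) (hτ_pos : ∀ ω, 0 < τ ω)
    (hind : IndepFun τ (fun (ω : Ω) (t : ℝ≥0) => γ t ω) P) (t : ℝ≥0) :
    ∫⁻ ω, (∫⁻ u in Set.Ioc (0 : ℝ) t, ENNReal.ofReal
        (bridgeDrift (P.map τ) u.toNNReal (randomGammaBridge γ τ u.toNNReal ω))) ∂P ≤ 1 := by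
  have h := lintegral_lintegral_bridgeDrift_mul hγ hτ hτ_pos hind (zero_le (a := t))
    (H := fun _ => 1) measurable_const (fun _ => le_rfl)
  simp only [mul_one, NNReal.coe_zero] at h
  rw [h]
  refine (lintegral_mono_ae (g := fun _ => 1) ?_).trans (by simp)
  filter_upwards [ae_isBridgePath hγ hτ_pos] with ω hω
  refine ENNReal.ofReal_le_one.2 ?_
  have h1 := hω.le_one t
  have h2 := hω.nonneg 0
  linarith

/-- The drift is integrable in time: its mean integral is the mean increment of the bridge. -/
theorem ae_intervalIntegrable_bridgeDrift (hγ : IsStandardGammaProcess γ P)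
    (hτ : Measurable τ) (hτ_pos : ∀ ω, 0 < τ ω)
    (hind : IndepFun τ (fun (ω : Ω) (t : ℝ≥0) => γ t ω) P) :
    ∀ᵐ ω ∂P, ∀ t : ℝ≥0, IntervalIntegrable (fun s : ℝ =>
      bridgeDrift (P.map τ) s.toNNReal (randomGammaBridge γ τ s.toNNReal ω)) volume 0 t := by
  have := Measure.isProbabilityMeasure_map (μ := P) hτ.aemeasurable
  have hfin : ∀ᵐ ω ∂P, ∀ n : ℕ, ∫⁻ u in Set.Ioc (0 : ℝ) ((n : ℝ≥0) : ℝ), ENNReal.ofReal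
      (bridgeDrift (P.map τ) u.toNNReal (randomGammaBridge γ τ u.toNNReal ω)) < ∞ := by
    rw [ae_all_iff]
    intro n
    refine ae_lt_top' ?_ ((lintegral_lintegral_bridgeDrift_le_one hγ hτ hτ_pos hind
      (n : ℝ≥0)).trans_lt ENNReal.one_lt_top).ne
    obtain ⟨Z, hZm, hZ⟩ := exists_measurable_version hγ hτ
    have hF : Measurable (fun p : Ω × ℝ =>
        ENNReal.ofReal (bridgeDrift (P.map τ) p.2.toNNReal (Z p.2.toNNReal p.1))) := by
      have hZ' : Measurable (fun p : Ω × ℝ => Z p.2.toNNReal p.1) :=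
        hZm.comp (f := fun p : Ω × ℝ => (p.2.toNNReal, p.1)) (by fun_prop)
      exact (measurable_bridgeDrift (P.map τ)).ennreal_ofReal.comp (f := fun p : Ω × ℝ =>
        (p.2.toNNReal, Z p.2.toNNReal p.1)) (by fun_prop)
    refine (hF.lintegral_prod_right'
      (ν := volume.restrict (Set.Ioc (0 : ℝ) ((n : ℝ≥0) : ℝ)))).aemeasurable.congr ?_
    filter_upwards [hZ] with ω hω
    simp only [hω]
  filter_upwards [hfin, ae_isBridgePath hγ hτ_pos] with ω hω hpath t
  obtain ⟨n, hn⟩ := exists_nat_ge t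
  rw [intervalIntegrable_iff_integrableOn_Ioc_of_le NNReal.zero_le_coe]
  refine IntegrableOn.mono_set (t := Set.Ioc (0 : ℝ) ((n : ℝ≥0) : ℝ)) ?_
    (Set.Ioc_subset_Ioc_right (by exact_mod_cast hn))
  refine ⟨(measurable_bridgeDrift_comp _ hpath.mono).aestronglyMeasurable, ?_⟩
  rw [hasFiniteIntegral_iff_ofReal (ae_of_all _ fun s => bridgeDrift_nonneg _ _ _)]
  exact hω n

/-! ### The martingale property and the length as a stopping time -/

theorem ae_mem_regularSet (hγ : IsStandardGammaProcess γ P)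
    (hτ : Measurable τ) (hτ_pos : ∀ ω, 0 < τ ω)
    (hind : IndepFun τ (fun (ω : Ω) (t : ℝ≥0) => γ t ω) P) :
    ∀ᵐ ω ∂P, ω ∈ regularSet P γ τ := by
  filter_upwards [ae_isBridgePath hγ hτ_pos,
    ae_intervalIntegrable_bridgeDrift hγ hτ hτ_pos hind] with ω h1 h2 using ⟨h1, h2⟩

variable [P.IsComplete]

theorem measurable_bridgeCompensator (hγ : IsStandardGammaProcess γ P)
    (hτ : Measurable τ) (hτ_pos : ∀ ω, 0 < τ ω)
    (hind : IndepFun τ (fun (ω : Ω) (t : ℝ≥0) => γ t ω) P) (t : ℝ≥0) :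
    Measurable[bridgeFiltration hγ hτ t] (bridgeCompensator P γ τ t) := by
  have := Measure.isProbabilityMeasure_map (μ := P) hτ.aemeasurable
  refine @measurable_intervalIntegral_of_rightContinuous Ω (bridgeFiltration hγ hτ t)
    (regularBridge P γ τ) t (fun s hs => ?_) continuousWithinAt_regularBridge
    (fun p => bridgeDrift (P.map τ) p.1 p.2) (measurable_bridgeDrift _)
  refine measurable_completedNaturalFiltration_of_ae_eq
    (measurable_randomGammaBridge_bridgeFiltration hγ hτ hs) ?_
  filter_upwards [ae_mem_regularSet hγ hτ hτ_pos hind] with ω hω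
  rw [regularBridge_of_mem hω]

theorem integrable_bridgeCompensator (hγ : IsStandardGammaProcess γ P)
    (hτ : Measurable τ) (hτ_pos : ∀ ω, 0 < τ ω)
    (hind : IndepFun τ (fun (ω : Ω) (t : ℝ≥0) => γ t ω) P) (t : ℝ≥0) :
    Integrable (bridgeCompensator P γ τ t) P := by
  have hm : Measurable (bridgeCompensator P γ τ t) :=
    (measurable_bridgeCompensator hγ hτ hτ_pos hind t).mono ((bridgeFiltration hγ hτ).le t) le_rfl
  refine ⟨hm.aestronglyMeasurable, ?_⟩
  rw [hasFiniteIntegral_iff_ofReal (ae_of_all _ fun ω => by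
    have := monotone_bridgeCompensator (P := P) (γ := γ) (τ := τ) ω (zero_le (a := t))
    simp only [bridgeCompensator_zero] at this
    exact this)]
  refine (lintegral_congr_ae ?_).trans_lt
    ((lintegral_lintegral_bridgeDrift_le_one hγ hτ hτ_pos hind t).trans_lt ENNReal.one_lt_top)
  filter_upwards [ae_mem_regularSet hγ hτ hτ_pos hind] with ω hω
  have h := ofReal_bridgeCompensator_sub (zero_le (a := t)) hω
  rw [bridgeCompensator_zero, sub_zero, NNReal.coe_zero] at h
  exact h

theorem integrable_randomGammaBridge (hγ : IsStandardGammaProcess γ P)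
    (hτ : Measurable τ) (hτ_pos : ∀ ω, 0 < τ ω) (t : ℝ≥0) :
    Integrable (randomGammaBridge γ τ t) P := by
  refine Integrable.of_bound (C := 1)
    (hγ.measurable_randomGammaBridge hτ t).aestronglyMeasurable ?_
  filter_upwards [ae_isBridgePath hγ hτ_pos] with ω hω
  rw [Real.norm_of_nonneg (hω.nonneg t)]
  exact hω.le_one t

/-- The bridge and its compensator have the same mean increments on events of the past. -/
theorem setIntegral_bridgeCompensator_sub (hγ : IsStandardGammaProcess γ P)
    (hτ : Measurable τ) (hτ_pos : ∀ ω, 0 < τ ω)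
    (hind : IndepFun τ (fun (ω : Ω) (t : ℝ≥0) => γ t ω) P) {s t : ℝ≥0} (hst : s ≤ t) {S : Set Ω}
    (hS : MeasurableSet[bridgeFiltration hγ hτ s] S) :
    ∫ ω in S, (bridgeCompensator P γ τ t ω - bridgeCompensator P γ τ s ω) ∂P =
      ∫ ω in S, (randomGammaBridge γ τ t ω - randomGammaBridge γ τ s ω) ∂P := by
  obtain ⟨B, hB, hSB⟩ := exists_preimage_ae_eq_of_completedNaturalFiltration hS
  have hζm := hγ.measurable_randomGammaBridge hτ
  have hSm : MeasurableSet ((fun ω v => randomGammaBridge γ τ (min v s) ω) ⁻¹' B) :=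
    (measurable_pi_lambda _ fun v => hζm _) hB
  rw [setIntegral_congr_set hSB, setIntegral_congr_set hSB]
  have hA := fun t => (integrable_bridgeCompensator hγ hτ hτ_pos hind t).aestronglyMeasurable
  have hζsub : Measurable (fun ω => randomGammaBridge γ τ t ω - randomGammaBridge γ τ s ω) :=
    (hζm t).sub (hζm s)
  have hAsub : AEStronglyMeasurable
      (fun ω => bridgeCompensator P γ τ t ω - bridgeCompensator P γ τ s ω) P := (hA t).sub (hA s)
  have hnn : ∀ ω, 0 ≤ bridgeCompensator P γ τ t ω - bridgeCompensator P γ τ s ω := fun ω =>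
    sub_nonneg.2 (monotone_bridgeCompensator ω hst)
  rw [integral_eq_lintegral_of_nonneg_ae (ae_of_all _ hnn) hAsub.restrict,
    integral_eq_lintegral_of_nonneg_ae (ae_restrict_of_ae ?_) hζsub.aestronglyMeasurable.restrict]
  · congr 1
    rw [← lintegral_indicator hSm, ← lintegral_indicator hSm]
    have h := lintegral_lintegral_bridgeDrift_mul hγ hτ hτ_pos hind hst
      (H := B.indicator 1) (measurable_one.indicator hB)
      (fun w => Set.indicator_le_self' (fun _ _ => zero_le) w)
    have hmul : ∀ (f : Ω → ℝ≥0∞) (ω : Ω),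
        ((fun ω v => randomGammaBridge γ τ (min v s) ω) ⁻¹' B).indicator f ω =
          f ω * B.indicator 1 (fun v => randomGammaBridge γ τ (min v s) ω) := fun f ω => by
      by_cases hω : (fun v => randomGammaBridge γ τ (min v s) ω) ∈ B
      · rw [Set.indicator_of_mem (Set.mem_preimage.2 hω), Set.indicator_of_mem hω, Pi.one_apply,
          mul_one]
      · rw [Set.indicator_of_notMem (mt Set.mem_preimage.1 hω), Set.indicator_of_notMem hω,
          mul_zero]
    simp only [hmul]
    rw [← h]
    refine lintegral_congr_ae ?_
    filter_upwards [ae_mem_regularSet hγ hτ hτ_pos hind] with ω hω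
    rw [ofReal_bridgeCompensator_sub hst hω]
  · filter_upwards [ae_isBridgePath hγ hτ_pos] with ω hω
    exact sub_nonneg.2 (hω.mono hst)

theorem martingale_randomGammaBridge_sub (hγ : IsStandardGammaProcess γ P)
    (hτ : Measurable τ) (hτ_pos : ∀ ω, 0 < τ ω)
    (hind : IndepFun τ (fun (ω : Ω) (t : ℝ≥0) => γ t ω) P) :
    Martingale (fun t ω => randomGammaBridge γ τ t ω - bridgeCompensator P γ τ t ω)
      (bridgeFiltration hγ hτ) P := by
  have hζ := integrable_randomGammaBridge hγ hτ hτ_pos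
  have hA := integrable_bridgeCompensator hγ hτ hτ_pos hind
  have hmeas : ∀ t, Measurable[bridgeFiltration hγ hτ t]
      (fun ω => randomGammaBridge γ τ t ω - bridgeCompensator P γ τ t ω) := fun t =>
    @Measurable.sub _ _ _ _ _ (randomGammaBridge γ τ t) (bridgeCompensator P γ τ t) _
      (measurable_randomGammaBridge_bridgeFiltration hγ hτ le_rfl)
      (measurable_bridgeCompensator hγ hτ hτ_pos hind t)
  refine ⟨fun t => (hmeas t).stronglyMeasurable, fun s t hst => ?_⟩
  refine (ae_eq_condExp_of_forall_setIntegral_eq ((bridgeFiltration hγ hτ).le s)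
    ((hζ t).sub (hA t)) (fun S _ _ => ((hζ s).sub (hA s)).integrableOn) (fun S hS _ => ?_)
    (hmeas s).stronglyMeasurable.aestronglyMeasurable).symm
  have h := setIntegral_bridgeCompensator_sub hγ hτ hτ_pos hind hst hS
  rw [integral_sub (hA t).integrableOn (hA s).integrableOn,
    integral_sub (hζ t).integrableOn (hζ s).integrableOn] at h
  simp only [Pi.sub_apply]
  rw [integral_sub (hζ s).integrableOn (hA s).integrableOn,
    integral_sub (hζ t).integrableOn (hA t).integrableOn]
  linarith

/-- The event `τ ≤ t` is, up to a null set, the event that the bridge is at `1` at time `t`. -/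
theorem isStoppingTime_length (hγ : IsStandardGammaProcess γ P)
    (hτ : Measurable τ) (hτ_pos : ∀ ω, 0 < τ ω) :
    IsStoppingTime (bridgeFiltration hγ hτ) (fun ω => (τ ω : WithTop ℝ≥0)) := by
  intro t
  refine measurableSet_completedNaturalFiltration_of_ae_eq (S := randomGammaBridge γ τ t ⁻¹' {1})
    (measurable_randomGammaBridge_bridgeFiltration hγ hτ le_rfl (measurableSet_singleton 1)) ?_
  filter_upwards [ae_isBridgePath hγ hτ_pos] with ω hω
  refine propext (?_ : randomGammaBridge γ τ t ω = 1 ↔ (τ ω : WithTop ℝ≥0) ≤ t)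
  rw [WithTop.coe_le_coe]
  exact ⟨fun h => not_lt.1 fun hlt => (hω.lt_one t hlt).ne h, hω.eq_one t⟩

end Bridge

/-! ### The semimartingale decomposition -/

theorem mainTheorem2 {Ω : Type*} [mΩ : MeasurableSpace Ω] (P : Measure Ω)
    [IsProbabilityMeasure P] [P.IsComplete]
    (γ : ℝ≥0 → Ω → ℝ) (hγ : IsStandardGammaProcess γ P)
    (τ : Ω → ℝ≥0) (hτ : Measurable τ) (hτ_pos : ∀ ω, 0 < τ ω)
    (hind : IndepFun τ (fun (ω : Ω) (t : ℝ≥0) => γ t ω) P) :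
    IsSemimartingale (randomGammaBridge γ τ) (bridgeFiltration hγ hτ) P ∧
    IsStoppingTime (bridgeFiltration hγ hτ) (fun ω => (τ ω : WithTop ℝ≥0)) ∧
    -- the integrals in the decomposition converge
    (∀ᵐ ω ∂P, ∀ s : ℝ≥0, 0 < randomGammaBridge γ τ s ω → randomGammaBridge γ τ s ω < 1 →
      IntegrableOn (fun r => bridgeDensity s r (randomGammaBridge γ τ s ω))
        (Set.Ioi s) (P.map τ) ∧
      IntegrableOn (fun r : ℝ≥0 => ((r : ℝ) - (s : ℝ))⁻¹ *
        bridgePhi (P.map τ) s r (randomGammaBridge γ τ s ω)) (Set.Ioi s) (P.map τ)) ∧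
    (∀ᵐ ω ∂P, ∀ t : ℝ≥0, IntervalIntegrable (fun s : ℝ =>
      bridgeDrift (P.map τ) s.toNNReal (randomGammaBridge γ τ s.toNNReal ω)) volume 0 t) ∧
    -- the canonical decomposition
    ∃ N A : ℝ≥0 → Ω → ℝ,
      IsCanonicalDecomposition (randomGammaBridge γ τ) N A (bridgeFiltration hγ hτ) P ∧
      (∀ᵐ ω ∂P, ∀ t : ℝ≥0, A t ω = ∫ s in (0 : ℝ)..t,
        bridgeDrift (P.map τ) s.toNNReal (randomGammaBridge γ τ s.toNNReal ω)) ∧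
      Martingale N (bridgeFiltration hγ hτ) P ∧
      (∀ᵐ ω ∂P, ∀ t : ℝ≥0, N t ω = N (min t (τ ω)) ω) := by
  have := Measure.isProbabilityMeasure_map (μ := P) hτ.aemeasurable
  have hreg := ae_mem_regularSet hγ hτ hτ_pos hind
  have hmart := martingale_randomGammaBridge_sub hγ hτ hτ_pos hind
  have hloc : IsLocalMartingale
      (fun t ω => randomGammaBridge γ τ t ω - bridgeCompensator P γ τ t ω)
      (bridgeFiltration hγ hτ) P := by
    refine Locally.of_prop ⟨hmart, ?_⟩
    filter_upwards [hreg] with ω hω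
    exact hω.1.cadlag.sub (continuous_bridgeCompensator ω).isCadlag
  have hadapted : StronglyAdapted (bridgeFiltration hγ hτ) (bridgeCompensator P γ τ) := fun t =>
    (measurable_bridgeCompensator hγ hτ hτ_pos hind t).stronglyMeasurable
  have hfv : HasFiniteVariationPaths (bridgeCompensator P γ τ) P :=
    ae_of_all _ fun ω => ⟨bridgeCompensator_zero ω, (continuous_bridgeCompensator ω).isCadlag,
      ((monotone_bridgeCompensator ω).monotoneOn _).locallyBoundedVariationOn⟩
  have hadd : ∀ᵐ ω ∂P, ∀ t, randomGammaBridge γ τ t ω =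
      (randomGammaBridge γ τ t ω - bridgeCompensator P γ τ t ω) + bridgeCompensator P γ τ t ω :=
    ae_of_all _ fun ω t => (sub_add_cancel _ _).symm
  refine ⟨⟨fun t => (measurable_randomGammaBridge_bridgeFiltration hγ hτ le_rfl).stronglyMeasurable,
      ?_, _, _, hloc, hadapted, hfv, hadd⟩, isStoppingTime_length hγ hτ hτ_pos,
    ae_of_all _ fun ω s _ _ => ⟨integrableOn_bridgeDensity _ _ _,
      integrableOn_inv_mul_bridgePhi _ _ _⟩,
    ae_intervalIntegrable_bridgeDrift hγ hτ hτ_pos hind, _, bridgeCompensator P γ τ,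
    ⟨hloc, hadapted.isStronglyPredictable_of_continuous continuous_bridgeCompensator, hfv, hadd⟩,
    ?_, hmart, ?_⟩
  · filter_upwards [hreg] with ω hω using hω.1.cadlag
  · filter_upwards [hreg] with ω hω t using bridgeCompensator_of_mem hω t
  · filter_upwards [hreg] with ω hω t
    rw [bridgeCompensator_min hω]
    simp only [randomGammaBridge, gammaBridge, min_assoc, min_self]
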